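/- **Setting.** Let $D$ be a probability distribution on $\mathcal X\times\{-1,1\}$ with marginal $D_{\mathcal X}$ and conditional label distributions $D_{Y|X}$. Let $\mathcal H$ be a class of classifiers $h:\mathcal X\to\{-1,1\}$ of VC dimension $d<\infty$, parametrized by a standard Borel space in a jointly measurable way. Let $\mathrm{err}_D(h)=\mathbb P_{(x,y)\sim D}(h(x)\ne y)$, and assume that $h^*(D)\in\mathcal H$ minimizes $\mathrm{err}_D$ over $\mathcal H$. For a labelled sample $S$, $\mathrm{err}_S(h)$ and $\rho_S(h,g)$ are the fractions of $(x,y)\in S$ with $h(x)\neq y$ and with $h(x)\ne g(x)$. The example oracle returns independent draws from $D_{\mathcal X}$; the labelling oracle, asked for the label of $x$, returns an independent draw from $D_{Y|X=x}$. A *confidence-rated predictor* $P$ receives $V\subseteq\mathcal H$, examples $z_1,\dots,z_n$ and $\eta\ge 0$, and outputs probabilities $\xi_i,\zeta_i,\gamma_i\ge0$ with $\xi_i+\zeta_i+\gamma_i=1$ of predicting $1$, predicting $-1$ and abstaining on $z_i$. It has *guaranteed error* if always $\sum_{i:h(z_i)=1}\zeta_i+\sum_{i:h(z_i)=-1}\xi_i\le\eta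 n$ for all $h\in V$. **Algorithm 1** (inputs: the oracles, $\mathcal H$, $P$, target excess error $\epsilon>0$, target confidence $\delta>0$). Let $k_0=\max(0,\lceil\log_2(1/\epsilon)\rceil)$ and $V_1=\mathcal H$. For $k=1,\dots,k_0$, let $\epsilon_k=\epsilon2^{k_0-k+1}$ and $\delta_k=\frac{\delta}{2(k_0-k+1)^2}$, and: 1. Draw a fresh unlabelled sample $U_k=(z_{k,1},\dots,z_{k,n_k})$ of size $n_k=\big\lceil192(\tfrac{256}{\epsilon_k})^2(d\ln\tfrac{256}{\epsilon_k}+\ln\tfrac{288}{\delta_k})\big\rceil$. 2. Run $P$ on $V_k$, $U_k$, $\eta=\epsilon_k/64$ to get abstention probabilities $\gamma_{k,i}$. Let $\phi_k=\frac1{n_k}\sum_i\gamma_{k,i}$ and let $\Gamma_k$ be the distribution on $U_k$ giving $z_{k,i}$ mass $\gamma_{k,i}/(n_k\phi_k)$. If $\phi_k=0$, put $V_{k+1}=V_k$ and go to the next epoch. 3. *Realizable version:* draw $m_k=\max\big(0,\big\lceil\tfrac{768\phi_k}{\epsilon_k}(d\ln\tfrac{768\phi_k}{\epsilon_k}+\ln\tfrac{48}{\delta_k})\big\rceil\big)$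 i.i.d. examples from $\Gamma_k$, query their labels to get $S_k$, and put $V_{k+1}=\{h\in V_k: h(x)=y\ \forall (x,y)\in S_k\}$. *Agnostic version:* let $V_{k+1}$ be the output of Algorithm 2 on $V=V_k$, $\Delta=\Gamma_k$, $\tilde\epsilon=\frac{\epsilon_k}{8\phi_k}$, $\tilde\delta=\frac{\delta_k}2$. Return an arbitrary $\hat h\in V_{k_0+1}$. **Algorithm 2** (inputs $V,\Delta,\tilde\epsilon,\tilde\delta$). For $j=1,2,\dots$: draw $n_j=2^j$ fresh i.i.d. examples from $\Delta$ and query their labels to get $S_j$; put $\tilde\delta_j=\tilde\delta/(j(j+1))$ and $\sigma_j=\sigma(n_j,\tilde\delta_j)$; let $\hat h_j\in V$ be an empirical risk minimizer over $S_j$; let $$V_j=\Big\{h\in V:\mathrm{err}_{S_j}(h)\le\mathrm{err}_{S_j}(\hat h_j)+\tfrac{\tilde\epsilon}2+\sigma_j+\sqrt{\sigma_j\,\rho_{S_j}(h,\hat h_j)}\Big\};$$ if $\sup_{h\in V_j}\big(\sigma_j+\sqrt{\sigma_j\,\rho_{S_j}(h,\hat h_j)}\big)\le\tilde\epsilon/6$,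 stop and return $V_j$. Here $\sigma(n,\delta)=\frac8n\big(2d\ln\frac{2e\max(n,d)}d+\ln\frac{24}\delta\big)$, the first term being $0$ if $d=0$. **Theorem (Consistency).** Let $P$ be any confidence-rated predictor with guaranteed error (whose outputs in the run of the algorithm are random variables). Suppose that Algorithm 1 is run in its agnostic version, or that $\mathrm{err}_D(h^*(D))=0$ and it is run in its realizable version. Then with probability at least $1-\delta$, Algorithm 1 returns a classifier (so $V_{k_0+1}\neq\emptyset$), and every classifier $\hat h\in V_{k_0+1}$ that it may return lies in $\mathcal H$ and satisfies $$\mathrm{err}_D(\hat h)-\mathrm{err}_D(h^*(D))\le\epsilon .$$ -/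

import Mathlib

open MeasureTheory ProbabilityTheory

namespace ActiveLearning

/-! Labels are Booleans: `true` is the label `+1` and `false` is the label `-1`.
A classifier on the instance space `X` is a function `X → Bool`. -/

/-! ## Hypothesis classes and errors -/

/-- `H` shatters the finite set `s`: every labelling of `s` is realized by some `h ∈ H`. -/
def Shatters {X : Type*} (H : Set (X → Bool)) (s : Finset X) : Prop :=
  ∀ b : X → Bool, ∃ h ∈ H, ∀ x ∈ s, h x = b x

/-- `H` has (finite) VC dimension `d`. -/
def HasVCDim {X : Type*} (H : Set (X → Bool)) (d : ℕ) : Prop :=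
  (∃ s : Finset X, s.card = d ∧ Shatters H s) ∧ ∀ s : Finset X, Shatters H s → s.card ≤ d

/-- The usual measurability convention for hypothesis classes ("image admissible Suslin"):
`H` can be parametrized by a standard Borel space in such a way that `(θ, x) ↦ h_θ(x)` is jointly
measurable. In particular every `h ∈ H` is measurable. -/
def Admissible {X : Type*} [MeasurableSpace X] (H : Set (X → Bool)) : Prop :=
  ∃ (Θ : Type) (_ : MeasurableSpace Θ) (_ : StandardBorelSpace Θ) (f : Θ → X → Bool),
    Measurable (fun p : Θ × X => f p.1 p.2) ∧ Set.range f = H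

/-- `err_D(h)`, the probability under `D` that `h(x) ≠ y`. -/
noncomputable def err {X : Type*} [MeasurableSpace X] (D : Measure (X × Bool)) (h : X → Bool) : ℝ :=
  D.real {p | h p.1 ≠ p.2}

/-- `h` is a risk minimizer `h^*(D)` of the class `H`. -/
def IsRiskMinimizer {X : Type*} [MeasurableSpace X] (D : Measure (X × Bool))
    (H : Set (X → Bool)) (h : X → Bool) : Prop :=
  h ∈ H ∧ ∀ g ∈ H, err D h ≤ err D g

/-- `err_S(h)`, the error of `h` under the uniform distribution over the labelled sample `s`. -/
noncomputable def empErr {X : Type*} {n : ℕ} (s : Fin n → X × Bool) (h : X → Bool) : ℝ :=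
  ((Finset.univ.filter fun i => h (s i).1 ≠ (s i).2).card : ℝ) / n

/-- `ρ_S(h, g)`, the disagreement of `h` and `g` under the uniform distribution over `s`. -/
noncomputable def empDis {X : Type*} {n : ℕ} (s : Fin n → X × Bool) (h g : X → Bool) : ℝ :=
  ((Finset.univ.filter fun i => h (s i).1 ≠ g (s i).1).card : ℝ) / n

/-! ## Subroutines -/

/-- A (soft) confidence-rated predictor. On input a set `V` of hypotheses, unlabelled examples
`z_1, …, z_n` and a number `η` it outputs for each `i` the probabilities `xi i`, `zeta i`, `gamma i`
of predicting `+1`, of predicting `-1` and of abstaining on `z_i`. -/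
structure Predictor (X : Type*) where
  xi : Set (X → Bool) → (n : ℕ) → (Fin n → X) → ℝ → Fin n → ℝ
  zeta : Set (X → Bool) → (n : ℕ) → (Fin n → X) → ℝ → Fin n → ℝ
  gamma : Set (X → Bool) → (n : ℕ) → (Fin n → X) → ℝ → Fin n → ℝ

/-- The predictor outputs probabilities, and has guaranteed error: on inputs `V ⊆ H`, `z`, `η`,
for each `h ∈ V` the probability, over a uniformly random `z_i` and the random choices of the
predictor, that it predicts a label different from `h(z_i)` is at most `η`. -/
def Predictor.HasGuaranteedError {X : Type*} (P : Predictor X) (H : Set (X → Bool)) : Prop :=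
  ∀ V ⊆ H, ∀ (n : ℕ) (z : Fin n → X) (η : ℝ), 0 ≤ η →
    (∀ i, 0 ≤ P.xi V n z η i ∧ 0 ≤ P.zeta V n z η i ∧ 0 ≤ P.gamma V n z η i ∧
      P.xi V n z η i + P.zeta V n z η i + P.gamma V n z η i = 1) ∧
    ∀ h ∈ V, (∑ i, if h (z i) = true then P.zeta V n z η i else P.xi V n z η i) ≤ η * n

/-- An empirical risk minimization routine: it returns, for each nonempty set `V` of hypotheses and
each labelled sample, a hypothesis in `V` of least empirical error (ties broken in any way). -/
def IsERM {X : Type*} (erm : Set (X → Bool) → (n : ℕ) → (Fin n → X × Bool) → X → Bool) : Prop :=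
  ∀ (V : Set (X → Bool)) (n : ℕ) (s : Fin n → X × Bool), V.Nonempty →
    erm V n s ∈ V ∧ ∀ h ∈ V, empErr s (erm V n s) ≤ empErr s h

/-! ## The adaptive label query procedure -/

/-- `σ(n, δ) = (8 / n) (2 d ln (2 e n / d) + ln (24 / δ))` for `n ≥ d`. The logarithm is the
Sauer bound, which makes sense for `n ≥ d` only; for `n < d` the value `ln (2 e)` at `n = d` is
used in its place. -/
noncomputable def sigma (d n : ℕ) (δ : ℝ) : ℝ :=
  8 / n * (2 * d * Real.log (2 * Real.exp 1 * (max n d : ℕ) / d) + Real.log (24 / δ))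

/-- The set `V_j` computed in round `j` from the sample `s` of size `2 ^ j`, where `hhat` is the
empirical risk minimizer of the round and `τ`, `β` are target excess error and confidence. -/
def roundSet {X : Type*} (d : ℕ) (V : Set (X → Bool)) (τ β : ℝ) (j : ℕ)
    (s : Fin (2 ^ j) → X × Bool) (hhat : X → Bool) : Set (X → Bool) :=
  {h ∈ V | empErr s h ≤ empErr s hhat + τ / 2 + sigma d (2 ^ j) (β / (j * (j + 1)))
      + √(sigma d (2 ^ j) (β / (j * (j + 1))) * empDis s h hhat)}

/-- The stopping criterion in round `j`; the supremum over `V_j` is at most `τ / 6`. -/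
def Stops {X : Type*} (d : ℕ) (V : Set (X → Bool)) (τ β : ℝ) (j : ℕ)
    (s : Fin (2 ^ j) → X × Bool) (hhat : X → Bool) : Prop :=
  ∀ h ∈ roundSet d V τ β j s hhat,
    sigma d (2 ^ j) (β / (j * (j + 1))) + √(sigma d (2 ^ j) (β / (j * (j + 1))) * empDis s h hhat)
      ≤ τ / 6

/-- The result of the adaptive procedure: the set `V_{j_0}`, where `j_0` is the first of the rounds
`1, 2, …` in which the stopping criterion holds. Round `j` uses the first `2 ^ j` elements of the
sequence `s j` of labelled examples. If the procedure never halts, the result is `∅`, that is,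
no hypothesis can be returned. -/
def adaptiveQuery {X : Type*}
    (erm : Set (X → Bool) → (n : ℕ) → (Fin n → X × Bool) → X → Bool)
    (d : ℕ) (V : Set (X → Bool)) (τ β : ℝ) (s : ℕ → ℕ → X × Bool) : Set (X → Bool) :=
  let S : (j : ℕ) → Fin (2 ^ j) → X × Bool := fun j i => s j i
  let hhat : ℕ → X → Bool := fun j => erm V (2 ^ j) (S j)
  {h | ∃ j₀, 1 ≤ j₀ ∧ Stops d V τ β j₀ (S j₀) (hhat j₀) ∧
    (∀ j, 1 ≤ j → j < j₀ → ¬ Stops d V τ β j (S j) (hhat j)) ∧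
    h ∈ roundSet d V τ β j₀ (S j₀) (hhat j₀)}

/-! ## The active learning algorithm -/

/-- Whether the algorithm is run in its realizable or in its non-realizable version. -/
inductive Setting where
  | realizable
  | agnostic

/-- The inputs of the active learning algorithm, apart from the two oracles. -/
structure Input (X : Type*) where
  setting : Setting
  /-- the hypothesis class -/
  H : Set (X → Bool)
  /-- its VC dimension -/
  d : ℕ
  /-- the confidence-rated predictor -/
  P : Predictor X
  /-- the empirical risk minimization routine -/
  erm : Set (X → Bool) → (n : ℕ) → (Fin n → X × Bool) → X → Bool
  /-- target excess error -/
  ε : ℝ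
  /-- target confidence -/
  δ : ℝ

namespace Input

variable {X : Type*} (I : Input X)

/-- The number `k₀ = ⌈log₂ (1 / ε)⌉` of epochs; the epochs are `k = 1, …, k₀`. -/
noncomputable def k₀ : ℕ := ⌈Real.logb 2 (1 / I.ε)⌉₊

/-- `ε_k = ε 2 ^ (k₀ - k + 1)`, for `k ≤ k₀ + 1`. -/
noncomputable def epsK (k : ℕ) : ℝ := I.ε * 2 ^ (I.k₀ + 1 - k)

/-- `δ_k = δ / (2 (k₀ - k + 1) ^ 2)`, for `k ≤ k₀`. -/
noncomputable def deltaK (k : ℕ) : ℝ := I.δ / (2 * ((I.k₀ + 1 - k : ℕ) : ℝ) ^ 2)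

/-- The size `n_k` of the unlabelled sample of epoch `k`, rounded up to an integer. -/
noncomputable def sizeU (k : ℕ) : ℕ :=
  ⌈192 * (256 / I.epsK k) ^ 2 *
    (I.d * Real.log (256 / I.epsK k) + Real.log (288 / I.deltaK k))⌉₊

/-- The abstention probabilities `γ_{k,i}` obtained in epoch `k` from the candidate set `V` and the
unlabelled sample `u`. -/
noncomputable def abstain (k : ℕ) (V : Set (X → Bool)) (u : Fin (I.sizeU k) → X) : Fin (I.sizeU k) → ℝ :=
  I.P.gamma V (I.sizeU k) u (I.epsK k / 64)

/-- `φ_k`, the average abstention probability. -/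
noncomputable def phi (k : ℕ) (V : Set (X → Bool)) (u : Fin (I.sizeU k) → X) : ℝ :=
  (∑ i, I.abstain k V u i) / I.sizeU k

/-- The number `m_k` of label queries of epoch `k` in the realizable case, rounded up to a natural
number. -/
noncomputable def numQueries (k : ℕ) (φ : ℝ) : ℕ :=
  ⌈768 * φ / I.epsK k * (I.d * Real.log (768 * φ / I.epsK k) + Real.log (48 / I.deltaK k))⌉₊

/-- Epoch `k`: the new candidate set, computed from the candidate set `V`, the unlabelled sample `u`
and labelled examples `s j i`. The realizable version reads `s 0 i` for `i < m_k`; the agnostic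
version reads `s j i` for `i < 2 ^ j` in round `j ≥ 1` of the adaptive procedure. If `φ_k = 0`,
then no label is queried and the candidate set is kept. -/
noncomputable def epoch (k : ℕ) (V : Set (X → Bool)) (u : Fin (I.sizeU k) → X)
    (s : ℕ → ℕ → X × Bool) : Set (X → Bool) :=
  match I.setting with
  | .realizable => {h ∈ V | ∀ i < I.numQueries k (I.phi k V u), h (s 0 i).1 = (s 0 i).2}
  | .agnostic =>
      if I.phi k V u = 0 then V
      else adaptiveQuery I.erm I.d V (I.epsK k / (8 * I.phi k V u)) (I.deltaK k / 2) s

/-- The candidate set after `k` epochs, that is, `V_{k+1}`. -/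
noncomputable def candidates (u : (k : ℕ) → Fin (I.sizeU k) → X) (s : ℕ → ℕ → ℕ → X × Bool) :
    ℕ → Set (X → Bool)
  | 0 => I.H
  | k + 1 => I.epoch (k + 1) (candidates u s k) (u (k + 1)) (s (k + 1))

end Input

/-- The law on `X × Bool` of a queried labelled example `(x, y)`: `x` is drawn from the
distribution `Γ` which gives `z i` a mass proportional to `γ i`, and `y` is drawn from the
conditional distribution `D_{Y|X = x}` by the labelling oracle. (If `γ = 0` nothing is ever queried
and the value is immaterial.) -/
noncomputable def queryLaw {X : Type*} [MeasurableSpace X] (D : Measure (X × Bool))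
    [IsProbabilityMeasure D] {n : ℕ} (z : Fin n → X) (γ : Fin n → ℝ) : Measure (X × Bool) :=
  open scoped Classical in
  if ∑ i, γ i = 0 then D
  else ∑ i, ENNReal.ofReal (γ i / ∑ l, γ l) • (D.condKernel (z i)).map (Prod.mk (z i))

section Run

variable {X Ω : Type*} [MeasurableSpace X] [MeasurableSpace Ω]

/-- The information from the epochs before `k`. -/
abbrev past {I : Input X} (U : (k : ℕ) → Ω → Fin (I.sizeU k) → X) (S : ℕ → Ω → ℕ → ℕ → X × Bool)
    (k : ℕ) : MeasurableSpace Ω :=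
  ⨆ i ∈ Finset.Ico 1 k, (MeasurableSpace.comap (U i) inferInstance ⊔
    MeasurableSpace.comap (S i) inferInstance)

/-- The information from the epochs before `k` and the unlabelled sample of epoch `k`. -/
abbrev pastU {I : Input X} (U : (k : ℕ) → Ω → Fin (I.sizeU k) → X) (S : ℕ → Ω → ℕ → ℕ → X × Bool)
    (k : ℕ) : MeasurableSpace Ω :=
  past U S k ⊔ MeasurableSpace.comap (U k) inferInstance

/-- A run of the active learning algorithm with inputs `I` and oracles for `D`, on the probability
space `(Ω, μ)`. Here `U k` is the unlabelled sample of epoch `k`, and the `S k ω j i` are the labelled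
examples which the algorithm may query in epoch `k`.
* `U k` is a fresh i.i.d. sample from the marginal of `D` on `X`.
* Given the past and `U k`, the labelled examples of epoch `k` are i.i.d. with law `queryLaw`, where
  the abstention probabilities come from the predictor, run on the current candidate set and `U k`.
* Measurability convention: these abstention probabilities are random variables, determined (up to
  null sets) by the past and `U k`. -/
structure IsRun (D : Measure (X × Bool)) [IsProbabilityMeasure D] (I : Input X) (μ : Measure Ω)
    (U : (k : ℕ) → Ω → Fin (I.sizeU k) → X) (S : ℕ → Ω → ℕ → ℕ → X × Bool) : Prop where
  measurable_U : ∀ k ∈ Finset.Icc 1 I.k₀, Measurable (U k)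
  measurable_S : ∀ k ∈ Finset.Icc 1 I.k₀, Measurable (S k)
  law_U : ∀ k ∈ Finset.Icc 1 I.k₀, μ.map (U k) = Measure.pi fun _ => D.fst
  fresh_U : ∀ k ∈ Finset.Icc 1 I.k₀,
    Indep (MeasurableSpace.comap (U k) inferInstance) (past U S k) μ
  measurable_abstain : ∀ k ∈ Finset.Icc 1 I.k₀, ∀ i, AEStronglyMeasurable[pastU U S k]
    (fun ω => I.abstain k (I.candidates (fun l => U l ω) (fun l => S l ω) (k - 1)) (U k ω) i) μ
  law_S : ∀ k ∈ Finset.Icc 1 I.k₀, ∀ A : Set Ω, MeasurableSet[pastU U S k] A →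
    ∀ (F : Finset (ℕ × ℕ)) (B : ℕ × ℕ → Set (X × Bool)), (∀ t, MeasurableSet (B t)) →
      μ (A ∩ {ω | ∀ t ∈ F, S k ω t.1 t.2 ∈ B t}) =
        ∫⁻ ω in A, ∏ t ∈ F, queryLaw D (U k ω)
          (I.abstain k (I.candidates (fun l => U l ω) (fun l => S l ω) (k - 1)) (U k ω)) (B t) ∂μ

end Run

end ActiveLearning

namespace ActiveLearning

open Filter Topology

/-! ## Projections of measurable sets are universally measurable -/

/-! Fix an epoch `k` with candidate set `V`. For a classifier, average over the unlabelled sample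
its conditional probability of error. The difference of this average between two classifiers of `V`
splits into the part weighted by the abstention probabilities, which is `φ_k` times the difference
of their errors under the query law, and the part weighted by `1 - γ`. The second part only sees
points where the two classifiers disagree. There `1 - γ = ξ + ζ` is exactly the sum of what the
predictor's guarantee charges to the one and to the other, so this part is at most `2 ε_k / 64`
(`abs_sampleErr_sub_le`). Uniform convergence on the unlabelled sample costs another `ε_k / 32`
(`err_sub_le_of_goodU`). Hence a risk minimizer of `D` is optimal for the query law up to `ε_k / (16
φ_k)`, and every classifier of `V` whose excess over it under the query law is at most `ε_k / (8
φ_k)` has small excess error under `D`. The labelled samples select classifiers of the second kind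
without losing the minimizer (`epoch_spec`, with `adaptiveQuery_spec` for the agnostic version).
Only the membership of the minimizer is carried from epoch to epoch; the error bound is read off
from the last epoch, where `ε_k / 2 = ε`.

All probability enters through one relative deviation inequality: with high probability,
simultaneously for all pairs of the class, the empirical difference of losses exceeds the true one
by at most `σ + √(σ ρ)` (`measure_relDev_le`). It is proved by symmetrization with a ghost sample,
random exchanges within the double sample, Hoeffding's bound for signs, and the Sauer–Shelah lemma.
Uniformity over the whole class `H` makes the dependence of the candidate sets on the data harmless:
the past influences an epoch's labelled sample only through its query law, so the inequality is
applied conditionally and integrated over a Markov kernel (`measure_inter_relDev_le`).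

The deviation events are existential statements over an uncountable class. They are handled by
showing that projections of measurable sets along a standard Borel space are universally measurable
(`nullMeasurableSet_exists`). A union bound over rounds and epochs concludes. -/

/-- A sequence of bounds `m` such that the image of each box `{x | ∀ i < k, x i ≤ m i}` has outer
measure greater than `r`. -/
theorem exists_bounds_lt_measure_image {Y : Type*} [MeasurableSpace Y] (μ : Measure Y)
    (f : (ℕ → ℕ) → Y) {r : ENNReal} (hr : r < μ (Set.range f)) :
    ∃ m : ℕ → ℕ, ∀ k, r < μ (f '' {x | ∀ i < k, x i ≤ m i}) := by
  -- As `j` grows these images increase to the previous one. Continuity from below along increasing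
  -- unions holds for outer measure, so no measurability of the images is needed.
  have step : ∀ (k : ℕ) (m : ℕ → ℕ), r < μ (f '' {x | ∀ i < k, x i ≤ m i}) →
      ∃ j, r < μ (f '' {x | (∀ i < k, x i ≤ m i) ∧ x k ≤ j}) := by
    intro k m h
    have hU : f '' {x | ∀ i < k, x i ≤ m i}
        = ⋃ j, f '' {x | (∀ i < k, x i ≤ m i) ∧ x k ≤ j} := by
      rw [← Set.image_iUnion]
      congr 1
      ext x
      simp only [Set.mem_ofPred_eq, Set.mem_iUnion, exists_and_left]
      exact ⟨fun h => ⟨h, x k, le_rfl⟩, fun h => h.1⟩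
    rw [hU, Monotone.measure_iUnion] at h
    · exact lt_iSup_iff.1 h
    · intro a b hab
      exact Set.image_mono fun x hx => ⟨hx.1, hx.2.trans hab⟩
  choose! J hJ using step
  -- Stage `k + 1` changes entry `k` only, so entry `i` is frozen from stage `i + 1` on and the
  -- diagonal `M (i + 1) i` is the wanted sequence.
  let M : ℕ → ℕ → ℕ := fun n => Nat.rec (fun _ => 0) (fun k m => Function.update m k (J k m)) n
  have hMsucc : ∀ k, M (k + 1) = Function.update (M k) k (J k (M k)) := fun k => rfl
  have hstab : ∀ k i, i < k → M k i = M (i + 1) i := by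
    intro k
    induction k with
    | zero => intro i hi; omega
    | succ k ih =>
      intro i hi
      rcases Nat.lt_succ_iff_lt_or_eq.1 hi with h | h
      · rw [hMsucc, Function.update_of_ne h.ne, ih i h]
      · rw [h]
  refine ⟨fun i => M (i + 1) i, fun k => ?_⟩
  have hP : r < μ (f '' {x | ∀ i < k, x i ≤ M k i}) := by
    induction k with
    | zero => simpa using hr
    | succ k ih =>
      refine (hJ k (M k) ih).trans_eq ?_
      congr 2
      ext x
      rw [hMsucc, Set.mem_ofPred_eq, Set.mem_ofPred_eq]
      symm
      constructor
      · intro h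
        refine ⟨fun i hi => ?_, ?_⟩
        · simpa [Function.update_of_ne hi.ne] using h i (by omega)
        · simpa using h k (by omega)
      · rintro ⟨h1, h2⟩ i hi
        rcases Nat.lt_succ_iff_lt_or_eq.1 hi with h | h
        · simpa [Function.update_of_ne h.ne] using h1 i h
        · simpa [h] using h2
  refine hP.trans_eq ?_
  congr 2
  ext x
  exact forall₂_congr fun i hi => by rw [hstab k i hi]

/-- An open neighbourhood of the compact box contains a box given by finitely many bounds. -/
theorem exists_box_subset_of_isOpen {O : Set (ℕ → ℕ)} (hO : IsOpen O) (m : ℕ → ℕ)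
    (h : {x | ∀ i, x i ≤ m i} ⊆ O) : ∃ k, {x : ℕ → ℕ | ∀ i < k, x i ≤ m i} ⊆ O := by
  by_contra! hcon
  simp only [Set.not_subset] at hcon
  choose y hy hyO using hcon
  -- Truncation moves the points into the compact box without changing their first `k` coordinates,
  -- so a limit of the truncated points is also a limit of the original ones outside `O`.
  let y' : ℕ → ℕ → ℕ := fun k i => if i < k then y k i else 0
  have hK : IsCompact {x : ℕ → ℕ | ∀ i, x i ≤ m i} := by
    have := isCompact_univ_pi (fun i => (Set.finite_Iic (m i)).isCompact)
    convert this using 1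
    ext x; simp [Pi.le_def]
  have hy' : ∀ k, y' k ∈ {x : ℕ → ℕ | ∀ i, x i ≤ m i} := by
    intro k i
    simp only [y']
    split_ifs with hi
    · exact hy k i hi
    · exact Nat.zero_le _
  obtain ⟨x, hx, φ, hφ, hlim⟩ := hK.tendsto_subseq hy'
  have hlim2 : Tendsto (y ∘ φ) atTop (𝓝 x) := by
    rw [tendsto_pi_nhds] at hlim ⊢
    intro i
    refine (hlim i).congr' ?_
    filter_upwards [eventually_gt_atTop i] with n hn
    simp [y', hn.trans_le (hφ.id_le n)]
  have : x ∈ Oᶜ := hO.isClosed_compl.mem_of_tendsto hlim2 (Eventually.of_forall fun n => hyO _)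
  exact this (h hx)

/-- Analytic sets are universally measurable. -/
theorem nullMeasurableSet_of_analyticSet {Y : Type*} [TopologicalSpace Y] [PolishSpace Y]
    [MeasurableSpace Y] [BorelSpace Y] (μ : Measure Y) [IsFiniteMeasure μ] {A : Set Y}
    (hA : AnalyticSet A) : NullMeasurableSet A μ := by
  rw [AnalyticSet] at hA
  rcases hA with rfl | ⟨f, hf, rfl⟩
  · exact MeasurableSet.empty.nullMeasurableSet
  let := TopologicalSpace.upgradeIsCompletelyMetrizable Y
  -- Compact inner approximation. An open set around the image of the compact box contains the image
  -- of a box with finitely many constraints, whose outer measure exceeds `r`; outer regularity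
  -- passes this to the compact image.
  have key : ∀ r < μ (Set.range f), ∃ K, K ⊆ Set.range f ∧ IsCompact K ∧ r ≤ μ K := by
    intro r hr
    obtain ⟨m, hm⟩ := exists_bounds_lt_measure_image μ f hr
    refine ⟨f '' {x | ∀ i, x i ≤ m i}, Set.image_subset_range _ _, ?_, ?_⟩
    · refine IsCompact.image ?_ hf
      have := isCompact_univ_pi (fun i => (Set.finite_Iic (m i)).isCompact)
      convert this using 1
      ext x; simp [Pi.le_def]
    · refine le_of_forall_gt fun c hc => ?_
      obtain ⟨U, hU, hUo, hUc⟩ := Set.exists_isOpen_lt_of_lt _ c hc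
      obtain ⟨k, hk⟩ := exists_box_subset_of_isOpen (hUo.preimage hf) m (Set.image_subset_iff.1 hU)
      exact ((hm k).trans_le (measure_mono (Set.image_subset_iff.2 hk))).trans hUc
  by_cases h0 : μ (Set.range f) = 0
  · exact NullMeasurableSet.of_null h0
  obtain ⟨u, -, hu, hulim⟩ := exists_seq_strictMono_tendsto' (pos_iff_ne_zero.2 h0)
  choose K hKs hKc hKm using fun n => key (u n) (hu n).2
  have hmeas : MeasurableSet (⋃ n, K n) := MeasurableSet.iUnion fun n => (hKc n).measurableSet
  have : (⋃ n, K n) =ᵐ[μ] Set.range f := by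
    refine ae_eq_of_subset_of_measure_ge (Set.iUnion_subset hKs) ?_ hmeas.nullMeasurableSet
      (measure_ne_top _ _)
    exact le_of_tendsto' hulim fun n =>
      (hKm n).trans (measure_mono (Set.subset_iUnion K n))
  exact hmeas.nullMeasurableSet.congr this

/-- A measurable subset of a product depends on the second factor only through a measurable map
to the Cantor space. -/
theorem exists_cantor_preimage_eq {Θ Y : Type*} [MeasurableSpace Θ] [MeasurableSpace Y]
    {C : Set (Θ × Y)} (hC : MeasurableSet C) :
    ∃ (φ : Y → ℕ → Bool) (C' : Set (Θ × (ℕ → Bool))), Measurable φ ∧ MeasurableSet C' ∧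
      C = Prod.map id φ ⁻¹' C' := by
  classical
  rw [← generateFrom_prod] at hC
  induction C, hC using MeasurableSpace.generateFrom_induction with
  | hC t ht _ =>
    obtain ⟨s, hs, t, ht, rfl⟩ := ht
    simp only [Set.mem_ofPred_eq] at hs ht
    refine ⟨fun y _ => decide (y ∈ t), s ×ˢ {b | b 0 = true}, ?_, ?_, ?_⟩
    · refine measurable_pi_lambda _ fun _ => ?_
      refine measurable_to_bool ?_
      convert ht using 1
      ext y; simp
    · exact hs.prod (measurableSet_eq_fun (measurable_pi_apply 0) measurable_const)
    · ext p; simp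
  | empty => exact ⟨fun _ _ => true, ∅, measurable_const, MeasurableSet.empty, by simp⟩
  | compl t _ ih =>
    obtain ⟨φ, C', h1, h2, h3⟩ := ih
    exact ⟨φ, C'ᶜ, h1, h2.compl, by rw [h3]; rfl⟩
  | iUnion s _ ih =>
    choose φ C' h1 h2 h3 using ih
    -- Countably many Cantor codes are interleaved into one by the pairing function.
    refine ⟨fun y k => φ k.unpair.1 y k.unpair.2,
      ⋃ n, Prod.map id (fun b i => b (Nat.pair n i)) ⁻¹' C' n, ?_, ?_, ?_⟩
    · exact measurable_pi_lambda _ fun k => (measurable_pi_apply _).comp (h1 _)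
    · refine MeasurableSet.iUnion fun n => ?_
      refine Measurable.prodMap measurable_id ?_ (h2 n)
      exact measurable_pi_lambda _ fun k => measurable_pi_apply _
    · ext p
      simp only [Set.mem_iUnion, h3, Set.mem_preimage, Prod.map, Nat.unpair_pair, id]

/-- The projection of a measurable set along a standard Borel space is universally measurable. -/
theorem nullMeasurableSet_exists {Θ Y : Type*} [MeasurableSpace Θ] [StandardBorelSpace Θ]
    [MeasurableSpace Y] (μ : Measure Y) [IsFiniteMeasure μ] {p : Θ → Y → Prop}
    (hp : MeasurableSet {q : Θ × Y | p q.1 q.2}) : NullMeasurableSet {y | ∃ θ, p θ y} μ := by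
  obtain ⟨φ, C', h1, h2, h3⟩ := exists_cantor_preimage_eq hp
  have : {y | ∃ θ, p θ y} = φ ⁻¹' (Prod.snd '' C') := by
    ext y
    have h : ∀ θ, p θ y ↔ (θ, φ y) ∈ C' := fun θ => by
      have := Set.ext_iff.1 h3 (θ, y)
      simpa using this
    simp [h]
  rw [this]
  have : TopologicalSpace.IsCompletelyMetrizableSpace (ℕ → Bool) :=
    TopologicalSpace.IsCompletelyMetrizableSpace.pi_countable
  have hA : AnalyticSet (Prod.snd '' C') := h2.analyticSet_image measurable_snd
  exact (nullMeasurableSet_of_analyticSet (μ.map φ) hA).preimage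
    ⟨h1, Measure.AbsolutelyContinuous.rfl⟩

/-! ## Sums of independent centred variables are often nonpositive -/

/-- The first, second and fourth moments of a sum of independent centred random variables bounded
by `2`. -/
theorem moments_sum_of_iIndepFun {Ω ι : Type*} [MeasurableSpace Ω] {μ : Measure Ω}
    [IsProbabilityMeasure μ] {X : ι → Ω → ℝ} {v : ℝ} (hX : ∀ i, Measurable (X i))
    (hindep : iIndepFun X μ) (hbd : ∀ i ω, |X i ω| ≤ 2) (h1 : ∀ i, ∫ ω, X i ω ∂μ = 0)
    (h2 : ∀ i, ∫ ω, X i ω ^ 2 ∂μ = v) (s : Finset ι) :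
    ∫ ω, ∑ i ∈ s, X i ω ∂μ = 0 ∧ ∫ ω, (∑ i ∈ s, X i ω) ^ 2 ∂μ = s.card * v ∧
      ∫ ω, (∑ i ∈ s, X i ω) ^ 4 ∂μ ≤ 3 * (s.card * v) ^ 2 + 4 * (s.card * v) := by
  classical
  induction s using Finset.induction_on with
  | empty => simp
  | insert j s hj ih =>
    obtain ⟨e1, e2, e4⟩ := ih
    set W : Ω → ℝ := fun ω => ∑ i ∈ s, X i ω with hW
    have hWm : Measurable W := Finset.measurable_sum _ fun i _ => hX i
    have hWbd : ∀ ω, |W ω| ≤ s.card * 2 := fun ω => by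
      refine (Finset.abs_sum_le_sum_abs _ _).trans ?_
      simpa using Finset.sum_le_card_nsmul s _ 2 fun i _ => hbd i ω
    have hind : IndepFun W (X j) μ := by
      have := hindep.indepFun_finsetSum_of_notMem hX hj
      convert this using 1
      ext ω; simp [hW]
    have hint : ∀ a b : ℕ, Integrable (fun ω => W ω ^ a * X j ω ^ b) μ := by
      intro a b
      refine Integrable.of_bound ((hWm.pow_const a).mul ((hX j).pow_const b)).aestronglyMeasurable
        ((s.card * 2) ^ a * 2 ^ b) (Filter.Eventually.of_forall fun ω => ?_)
      rw [norm_mul, norm_pow, norm_pow]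
      gcongr
      · exact hWbd ω
      · exact hbd j ω
    have hmul : ∀ a b : ℕ, ∫ ω, W ω ^ a * X j ω ^ b ∂μ
        = (∫ ω, W ω ^ a ∂μ) * ∫ ω, X j ω ^ b ∂μ := by
      intro a b
      have := hind.comp (measurable_id.pow_const a) (measurable_id.pow_const b)
      exact this.integral_fun_mul_eq_mul_integral
        (hWm.pow_const a).aestronglyMeasurable ((hX j).pow_const b).aestronglyMeasurable
    have hX4 : ∫ ω, X j ω ^ 4 ∂μ ≤ 4 * v := by
      rw [← h2 j, ← integral_const_mul]
      refine integral_mono (by simpa using hint 0 4) (by simpa using (hint 0 2).const_mul 4) ?_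
      intro ω
      have := sq_le_sq' (by linarith [abs_le.1 (hbd j ω)] : -(2:ℝ) ≤ X j ω)
        (abs_le.1 (hbd j ω)).2
      change X j ω ^ 4 ≤ 4 * X j ω ^ 2
      nlinarith [sq_nonneg (X j ω)]
    have hsum : ∀ ω, ∑ i ∈ insert j s, X i ω = W ω + X j ω := fun ω => by
      rw [Finset.sum_insert hj, add_comm]
    simp_rw [hsum]
    have m1 : ∫ ω, W ω ∂μ = 0 := e1
    have m2 : ∫ ω, W ω ^ 2 ∂μ = s.card * v := e2
    have m4 : ∫ ω, W ω ^ 4 ∂μ ≤ 3 * (s.card * v) ^ 2 + 4 * (s.card * v) := e4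
    have hc : (((insert j s).card : ℕ) : ℝ) = s.card + 1 := by
      rw [Finset.card_insert_of_notMem hj]; push_cast; ring
    rw [hc]
    have hv : 0 ≤ v := by rw [← h2 j]; exact integral_nonneg fun ω => sq_nonneg _
    refine ⟨?_, ?_, ?_⟩
    · have : ∀ ω, W ω + X j ω = W ω ^ 1 * X j ω ^ 0 + W ω ^ 0 * X j ω ^ 1 := fun ω => by ring
      simp_rw [this]
      rw [integral_add (hint 1 0) (hint 0 1), hmul, hmul]
      simp [m1, h1]
    · have : ∀ ω, (W ω + X j ω) ^ 2 = W ω ^ 2 * X j ω ^ 0 + 2 * (W ω ^ 1 * X j ω ^ 1)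
          + W ω ^ 0 * X j ω ^ 2 := fun ω => by ring
      simp_rw [this]
      rw [integral_add ((hint 2 0).fun_add ((hint 1 1).const_mul 2)) (hint 0 2),
        integral_add (hint 2 0) ((hint 1 1).const_mul 2), integral_const_mul, hmul, hmul, hmul]
      simp [m1, m2, h1, h2]
      ring
    · have : ∀ ω, (W ω + X j ω) ^ 4 = W ω ^ 4 * X j ω ^ 0 + 4 * (W ω ^ 3 * X j ω ^ 1)
          + 6 * (W ω ^ 2 * X j ω ^ 2) + 4 * (W ω ^ 1 * X j ω ^ 3) + W ω ^ 0 * X j ω ^ 4 :=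
        fun ω => by ring
      simp_rw [this]
      have i1 := (hint 4 0)
      have i2 := (hint 3 1).const_mul 4
      have i3 := (hint 2 2).const_mul 6
      have i4 := (hint 1 3).const_mul 4
      have i5 := (hint 0 4)
      rw [integral_add (((i1.fun_add i2).fun_add i3).fun_add i4) i5,
        integral_add ((i1.fun_add i2).fun_add i3) i4,
        integral_add (i1.fun_add i2) i3, integral_add i1 i2]
      simp only [integral_const_mul, hmul]
      simp only [pow_one, pow_zero, m1, m2, h1, h2, integral_const, probReal_univ, smul_eq_mul]
      -- The terms with a first power of a centred factor have vanished. What remains is the old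
      -- fourth moment plus `6 (s.card * v) v` plus a fourth moment of at most `4 v`, and the new
      -- bound exceeds this by at least `3 v ^ 2`.
      nlinarith [mul_nonneg (Nat.cast_nonneg (α := ℝ) s.card) hv, sq_nonneg v]

/-- If the fourth moment is at most four times the squared variance, then a centred variable is
nonpositive with probability at least `1 / 24`. -/
theorem le_measureReal_nonpos_of_moments {Ω : Type*} [MeasurableSpace Ω] {μ : Measure Ω}
    [IsProbabilityMeasure μ] {W : Ω → ℝ} (hW : Measurable W) {B V : ℝ} (hB : ∀ ω, |W ω| ≤ B)
    (hV : 0 < V) (h1 : ∫ ω, W ω ∂μ = 0) (h2 : ∫ ω, W ω ^ 2 ∂μ = V)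
    (h4 : ∫ ω, W ω ^ 4 ∂μ ≤ 4 * V ^ 2) : 1 / 24 ≤ μ.real {ω | W ω ≤ 0} := by
  obtain ⟨r, hr, rfl⟩ : ∃ r : ℝ, 0 < r ∧ V = r ^ 2 :=
    ⟨√V, Real.sqrt_pos.2 hV, (Real.sq_sqrt hV.le).symm⟩
  have hms : MeasurableSet {ω | W ω ≤ 0} := measurableSet_le hW measurable_const
  have hint : ∀ a : ℕ, Integrable (fun ω => W ω ^ a) μ := by
    intro a
    refine Integrable.of_bound (hW.pow_const a).aestronglyMeasurable (B ^ a)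
      (Filter.Eventually.of_forall fun ω => ?_)
    rw [norm_pow]
    gcongr
    exact hB ω
  -- A polynomial minorant of the indicator of `x ≤ 0`, where `x = W / r`. For `x > 0` it equals `-x
  -- ((x - 3) ^ 2 (x + 6) + 54 x / 5) / 270`, which is negative. Its expectation is at least `3 / 50
  -- - 4 / 270`, which is above `1 / 24`.
  have hpt : ∀ ω, 3 / 50 / r ^ 2 * W ω ^ 2 - 1 / 270 / r ^ 4 * W ω ^ 4 - 1 / 5 / r * W ω ^ 1
      ≤ Set.indicator {ω | W ω ≤ 0} 1 ω := by
    intro ω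
    obtain ⟨x, hx⟩ : ∃ x, W ω = r * x := ⟨W ω / r, by field_simp⟩
    have e : 3 / 50 / r ^ 2 * W ω ^ 2 - 1 / 270 / r ^ 4 * W ω ^ 4 - 1 / 5 / r * W ω ^ 1
        = 3 / 50 * x ^ 2 - 1 / 270 * x ^ 4 - 1 / 5 * x := by
      rw [hx]; field_simp
    rw [e]
    by_cases h : W ω ≤ 0
    · rw [Set.indicator_of_mem (s := {ω | W ω ≤ 0}) h, Pi.one_apply]
      nlinarith [sq_nonneg (x ^ 2), sq_nonneg (x + 5), sq_nonneg (x + 3), sq_nonneg (x ^ 2 - 9)]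
    · rw [Set.indicator_of_notMem (s := {ω | W ω ≤ 0}) h]
      have hx0 : 0 < x := by
        rw [hx, not_le] at h
        exact pos_of_mul_pos_right h hr.le
      nlinarith [mul_nonneg hx0.le (mul_nonneg (sq_nonneg (x - 3)) (by linarith : 0 ≤ x + 6)),
        sq_nonneg x]
  have hle : ∫ ω, (3 / 50 / r ^ 2 * W ω ^ 2 - 1 / 270 / r ^ 4 * W ω ^ 4 - 1 / 5 / r * W ω ^ 1) ∂μ
      ≤ ∫ ω, Set.indicator {ω | W ω ≤ 0} (1 : Ω → ℝ) ω ∂μ := by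
    refine integral_mono ((((hint 2).const_mul _).sub ((hint 4).const_mul _)).sub
      ((hint 1).const_mul _)) ?_ hpt
    exact (integrable_const (1 : ℝ)).indicator hms
  rw [integral_indicator_one hms, integral_sub (((hint 2).const_mul _).sub' ((hint 4).const_mul _))
    ((hint 1).const_mul _), integral_sub ((hint 2).const_mul _) ((hint 4).const_mul _)] at hle
  simp only [integral_const_mul, pow_one, h1, h2, mul_zero, sub_zero] at hle
  have h5 : 1 / 270 / r ^ 4 * ∫ ω, W ω ^ 4 ∂μ ≤ 4 / 270 := by
    calc 1 / 270 / r ^ 4 * ∫ ω, W ω ^ 4 ∂μ ≤ 1 / 270 / r ^ 4 * (4 * (r ^ 2) ^ 2) := by gcongr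
      _ = 4 / 270 := by field_simp
  have h6 : 3 / 50 / r ^ 2 * r ^ 2 = 3 / 50 := by field_simp
  linarith

/-- A sum of i.i.d. centred random variables bounded by `2` is at most `6` with probability at
least `1 / 24`. -/
theorem le_measureReal_sum_le {Ω ι : Type*} [Fintype ι] [MeasurableSpace Ω] {μ : Measure Ω}
    [IsProbabilityMeasure μ] {X : ι → Ω → ℝ} {v : ℝ} (hX : ∀ i, Measurable (X i))
    (hindep : iIndepFun X μ) (hbd : ∀ i ω, |X i ω| ≤ 2) (h1 : ∀ i, ∫ ω, X i ω ∂μ = 0)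
    (h2 : ∀ i, ∫ ω, X i ω ^ 2 ∂μ = v) :
    1 / 24 ≤ μ.real {ω | ∑ i, X i ω ≤ 6} := by
  obtain ⟨e1, e2, e4⟩ := moments_sum_of_iIndepFun hX hindep hbd h1 h2 Finset.univ
  set W : Ω → ℝ := fun ω => ∑ i, X i ω with hW
  have hWm : Measurable W := Finset.measurable_sum _ fun i _ => hX i
  have hWbd : ∀ ω, |W ω| ≤ Fintype.card ι * 2 := fun ω => by
    refine (Finset.abs_sum_le_sum_abs _ _).trans ?_
    simpa using Finset.sum_le_card_nsmul Finset.univ _ 2 fun i _ => hbd i ω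
  set V : ℝ := (Finset.univ : Finset ι).card * v
  change ∫ ω, W ω ∂μ = 0 at e1
  change ∫ ω, W ω ^ 2 ∂μ = V at e2
  change ∫ ω, W ω ^ 4 ∂μ ≤ 3 * V ^ 2 + 4 * V at e4
  -- For variance at least `4` the fourth moment is at most `4 V ^ 2`, and even `W ≤ 0` is likely
  -- enough. For smaller variance Chebyshev's inequality at level `6` suffices.
  by_cases hV : 4 ≤ V
  · refine (le_measureReal_nonpos_of_moments hWm hWbd (by linarith) e1 e2 (by nlinarith)).trans ?_
    exact measureReal_mono fun ω (h : W ω ≤ 0) => (by linarith : W ω ≤ 6)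
  · have hint : Integrable (fun ω => W ω ^ 2) μ := by
      refine Integrable.of_bound (hWm.pow_const 2).aestronglyMeasurable ((Fintype.card ι * 2) ^ 2)
        (Filter.Eventually.of_forall fun ω => ?_)
      rw [norm_pow]
      gcongr
      exact hWbd ω
    have hms : MeasurableSet {ω | W ω ≤ 6} := measurableSet_le hWm measurable_const
    have hm := mul_meas_ge_le_integral_of_nonneg
      (Filter.Eventually.of_forall fun ω => sq_nonneg (W ω)) hint 36
    have hsub : {ω | W ω ≤ 6}ᶜ ⊆ {ω | 36 ≤ W ω ^ 2} := fun ω h => by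
      simp only [Set.mem_compl_iff, Set.mem_ofPred_eq, not_le] at h ⊢
      nlinarith
    have h3 := measureReal_mono hsub (μ := μ)
    rw [probReal_compl_eq_one_sub hms] at h3
    change 1 / 24 ≤ μ.real {ω | W ω ≤ 6}
    rw [e2] at hm
    linarith

/-! ## Random signs -/

/-- The sign `±1` of a Boolean. -/
def sgn (b : Bool) : ℝ := if b then 1 else -1

/-- Hoeffding's inequality for random signs, as a counting statement. -/
theorem card_signs_sum_gt_le {ι : Type*} [Fintype ι] [DecidableEq ι] (a : ι → ℝ) {L M : ℝ}
    (hL : 0 ≤ L) (hM : ∑ i, a i ^ 2 ≤ M) :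
    ((Finset.univ.filter fun b : ι → Bool => √(2 * L * M) < ∑ i, sgn (b i) * a i).card : ℝ)
      ≤ 2 ^ Fintype.card ι * Real.exp (-L) := by
  have hM0 : 0 ≤ M := (Finset.sum_nonneg fun i _ => sq_nonneg (a i)).trans hM
  rcases hM0.eq_or_lt with h0 | hpos
  · have ha : ∀ i, a i = 0 := fun i => by
      have := (Finset.sum_eq_zero_iff_of_nonneg fun i _ => sq_nonneg (a i)).1
        (le_antisymm (hM.trans h0.symm.le) (Finset.sum_nonneg fun i _ => sq_nonneg (a i))) i
        (Finset.mem_univ i)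
      simpa using this
    have : (Finset.univ.filter fun b : ι → Bool => √(2 * L * M) < ∑ i, sgn (b i) * a i) = ∅ := by
      ext b; simp [ha, (Real.sqrt_nonneg _).not_gt]
    rw [this]
    simp only [Finset.card_empty, Nat.cast_zero]
    positivity
  set t := √(2 * L * M) with ht
  have htsq : t ^ 2 = 2 * L * M := Real.sq_sqrt (by positivity)
  -- The optimal Chernoff parameter: the exponential moment is at most `exp (r ^ 2 M / 2) = exp L`,
  -- while the threshold contributes `exp (r t) = exp (2 L)`.
  set r := t / M with hr
  have hr0 : 0 ≤ r := by positivity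
  have hprod : ∑ b : ι → Bool, Real.exp (r * ∑ i, sgn (b i) * a i)
      = ∏ i, (2 * Real.cosh (r * a i)) := by
    have : ∀ i, 2 * Real.cosh (r * a i) = ∑ b : Bool, Real.exp (r * (sgn b * a i)) := fun i => by
      rw [Real.cosh_eq, Fintype.sum_bool]
      simp [sgn]
      ring
    simp_rw [this, Fintype.prod_sum, ← Real.exp_sum, Finset.mul_sum]
  have hle : ∏ i, (2 * Real.cosh (r * a i)) ≤ 2 ^ Fintype.card ι * Real.exp L := by
    calc ∏ i, (2 * Real.cosh (r * a i)) ≤ ∏ i, (2 * Real.exp ((r * a i) ^ 2 / 2)) := by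
          refine Finset.prod_le_prod (fun i _ => by positivity) fun i _ => ?_
          gcongr
          exact Real.cosh_le_exp_half_sq _
      _ = 2 ^ Fintype.card ι * Real.exp (r ^ 2 / 2 * ∑ i, a i ^ 2) := by
          rw [Finset.prod_mul_distrib, ← Real.exp_sum, Finset.mul_sum]
          simp only [Finset.prod_const, Finset.card_univ]
          congr 2
          exact Finset.sum_congr rfl fun i _ => by ring
      _ ≤ 2 ^ Fintype.card ι * Real.exp (r ^ 2 / 2 * M) := by gcongr
      _ = 2 ^ Fintype.card ι * Real.exp L := by
          congr 2
          rw [hr, div_pow, htsq]; field_simp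
  have hmk : ((Finset.univ.filter fun b : ι → Bool => t < ∑ i, sgn (b i) * a i).card : ℝ)
      * Real.exp (2 * L) ≤ ∑ b : ι → Bool, Real.exp (r * ∑ i, sgn (b i) * a i) := by
    rw [← nsmul_eq_mul]
    refine (Finset.card_nsmul_le_sum _ _ _ fun b hb => ?_).trans
      (Finset.sum_le_sum_of_subset_of_nonneg (Finset.filter_subset _ _)
        fun b _ _ => (Real.exp_pos _).le)
    have hb' := (Finset.mem_filter.1 hb).2
    refine Real.exp_le_exp.2 ?_
    calc 2 * L = r * t := by rw [hr]; field_simp; rw [htsq]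
      _ ≤ _ := by gcongr
  have h2 : Real.exp (2 * L) = Real.exp L * Real.exp L := by rw [← Real.exp_add]; ring_nf
  have h3 := hmk.trans (hprod.le.trans hle)
  rw [h2, ← mul_assoc] at h3
  rw [Real.exp_neg, ← div_eq_mul_inv, le_div_iff₀ (Real.exp_pos L)]
  exact le_of_mul_le_mul_right h3 (Real.exp_pos L)

/-- Two one-sided relative deviation bounds combine to a bound in terms of one sample. -/
theorem sub_add_sub_le_of_le_sqrt {a b c e κ : ℝ} (ha : 0 ≤ a) (hc : 0 ≤ c)
    (he : 0 ≤ e) (hκ : 0 ≤ κ) (h1 : a - b ≤ √(κ * (a + b))) (h2 : c - e ≤ √(κ * (c + e))) :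
    (a - b) + (c - e) ≤ κ + √(4 * κ * (a + e)) := by
  have k1 : a - b ≤ √(2 * κ * a) := by
    by_cases h : a ≤ b
    · exact (sub_nonpos.2 h).trans (Real.sqrt_nonneg _)
    · refine h1.trans (Real.sqrt_le_sqrt ?_)
      nlinarith
  -- With `x = c - e > κ`, the hypothesis reads `x ^ 2 ≤ κ (x + 2 e)`, whence `(x - κ) ^ 2 ≤ 2 κ e`.
  -- Thus `c` is eliminated, and only quantities of the first sample remain.
  have k2 : c - e ≤ κ + √(2 * κ * e) := by
    by_cases h : c - e ≤ κ
    · exact h.trans (by linarith [Real.sqrt_nonneg (2 * κ * e)])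
    · have hx := Real.sq_sqrt (show 0 ≤ κ * (c + e) by positivity)
      have hx' : (c - e) ^ 2 ≤ κ * (c + e) := by
        rw [← hx]
        exact pow_le_pow_left₀ (by linarith) h2 2
      rw [← sub_le_iff_le_add']
      refine Real.le_sqrt_of_sq_le ?_
      nlinarith
  have k3 : √(2 * κ * a) + √(2 * κ * e) ≤ √(4 * κ * (a + e)) := by
    refine Real.le_sqrt_of_sq_le ?_
    have e1 := Real.sq_sqrt (show 0 ≤ 2 * κ * a by positivity)
    have e2 := Real.sq_sqrt (show 0 ≤ 2 * κ * e by positivity)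
    nlinarith [sq_nonneg (√(2 * κ * a) - √(2 * κ * e))]
  linarith

/-- The pairs in `t`, exchanged at the indices `i` where `b i` is false. -/
def swapPairs {ι 𝒵 : Type*} (b : ι → Bool) (t : ι → 𝒵 × 𝒵) (i : ι) : 𝒵 × 𝒵 :=
  if b i then t i else (t i).swap

theorem measurePreserving_swapPairs {ι 𝒵 : Type*} [Fintype ι] [MeasurableSpace 𝒵] (P : Measure 𝒵)
    [IsProbabilityMeasure P] (b : ι → Bool) :
    MeasurePreserving (swapPairs b) (Measure.pi fun _ : ι => P.prod P)
      (Measure.pi fun _ : ι => P.prod P) := by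
  refine measurePreserving_pi (fun _ : ι => P.prod P) (fun _ : ι => P.prod P)
    (f := fun i z => if b i then z else z.swap) fun i => ?_
  by_cases h : b i
  · simpa [h] using! MeasurePreserving.id (P.prod P)
  · simpa [h] using Measure.measurePreserving_swap

/-- If every sample falls into `A` for at most a fraction `q` of the exchanges, then `A` has
probability at most `q`. -/
theorem measure_le_of_card_swapPairs_le {ι 𝒵 : Type*} [Fintype ι] [DecidableEq ι]
    [MeasurableSpace 𝒵] (P : Measure 𝒵) [IsProbabilityMeasure P] {A : Set (ι → 𝒵 × 𝒵)}
    (hA : NullMeasurableSet A (Measure.pi fun _ : ι => P.prod P)) {q : ℝ}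
    (hq : ∀ t, (Nat.card {b : ι → Bool // swapPairs b t ∈ A} : ℝ) ≤ 2 ^ Fintype.card ι * q) :
    (Measure.pi fun _ : ι => P.prod P) A ≤ ENNReal.ofReal q := by
  classical
  set μ := Measure.pi fun _ : ι => P.prod P
  have hpre : ∀ b : ι → Bool, NullMeasurableSet (swapPairs b ⁻¹' A) μ := fun b =>
    hA.preimage (measurePreserving_swapPairs P b).quasiMeasurePreserving
  have h1 : ∑ b : ι → Bool, μ (swapPairs b ⁻¹' A) = 2 ^ Fintype.card ι * μ A := by
    rw [Finset.sum_congr rfl fun b _ => (measurePreserving_swapPairs P b).measure_preimage hA]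
    simp [μ]
  have h2 : ∑ b : ι → Bool, μ (swapPairs b ⁻¹' A)
      = ∫⁻ t, ∑ b : ι → Bool, (swapPairs b ⁻¹' A).indicator (fun _ => (1 : ENNReal)) t ∂μ := by
    rw [lintegral_finsetSum' _ fun b _ => (aemeasurable_indicator_const_iff 1).2 (hpre b)]
    refine Finset.sum_congr rfl fun b _ => ?_
    rw [lintegral_indicator_const₀ (hpre b), one_mul]
  have h3 : ∫⁻ t, ∑ b : ι → Bool, (swapPairs b ⁻¹' A).indicator (fun _ => (1 : ENNReal)) t ∂μ
      ≤ ∫⁻ _, 2 ^ Fintype.card ι * ENNReal.ofReal q ∂μ := by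
    refine lintegral_mono fun t => ?_
    have e : ∑ b : ι → Bool, (swapPairs b ⁻¹' A).indicator (fun _ => (1 : ENNReal)) t
        = (Nat.card {b : ι → Bool // swapPairs b t ∈ A} : ENNReal) := by
      rw [Nat.card_eq_fintype_card, Fintype.card_subtype, Finset.card_filter]
      push_cast
      exact Finset.sum_congr rfl fun b _ => by simp [Set.indicator_apply]
    change ∑ b : ι → Bool, (swapPairs b ⁻¹' A).indicator (fun _ => (1 : ENNReal)) t ≤ _
    rw [e]
    have := ENNReal.ofReal_le_ofReal (hq t)
    rwa [ENNReal.ofReal_natCast, ENNReal.ofReal_mul (by positivity),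
      ENNReal.ofReal_pow (by norm_num), ENNReal.ofReal_ofNat] at this
  rw [lintegral_const, measure_univ, mul_one, ← h2, h1] at h3
  exact (ENNReal.mul_le_mul_iff_right (by positivity) (by finiteness)).1 h3

/-! ## Uniform relative deviations -/

/-- For each function `g` with values in `[-1, 1]`, a fresh sample has, with probability at least
`1 / 24`, a sum not much larger than its expectation. -/
theorem le_pi_sum_sub_integral_le {𝒵 : Type*} [MeasurableSpace 𝒵] (P : Measure 𝒵)
    [IsProbabilityMeasure P] (n : ℕ) {g : 𝒵 → ℝ} (hg : Measurable g) (hbd : ∀ z, |g z| ≤ 1) :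
    1 / 24 ≤ (Measure.pi fun _ : Fin n => P).real
      {s | ∑ i, g (s i) - n * ∫ z, g z ∂P ≤ 6} := by
  set m := ∫ z, g z ∂P
  have hm : |m| ≤ 1 := by
    have := norm_integral_le_of_norm_le_const (μ := P) (f := g) (C := 1)
      (Filter.Eventually.of_forall hbd)
    simpa using this
  have hint : Integrable g P :=
    Integrable.of_bound hg.aestronglyMeasurable 1 (Filter.Eventually.of_forall hbd)
  have hcomp : ∀ (i : Fin n) (f : 𝒵 → ℝ), Measurable f →
      ∫ s : Fin n → 𝒵, f (s i) ∂(Measure.pi fun _ : Fin n => P) = ∫ z, f z ∂P := by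
    intro i f hf
    have h := measurePreserving_eval (fun _ : Fin n => P) i
    conv_rhs => rw [← h.map_eq]
    rw [integral_map h.measurable.aemeasurable hf.aestronglyMeasurable]
  have hX := le_measureReal_sum_le (μ := Measure.pi fun _ : Fin n => P)
    (X := fun i s => g (s i) - m) (v := ∫ z, (g z - m) ^ 2 ∂P)
    (fun i => (hg.comp (measurable_pi_apply i)).sub_const m)
    (iIndepFun_pi (μ := fun _ : Fin n => P) (X := fun _ z => g z - m)
      fun _ => (hg.sub_const m).aemeasurable)
    (fun i s => (abs_sub _ _).trans (by linarith [hbd (s i)]))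
    (fun i => by
      rw [hcomp i (fun z => g z - m) (hg.sub_const m), integral_sub hint (integrable_const m)]
      simp [m])
    (fun i => hcomp i (fun z => (g z - m) ^ 2) ((hg.sub_const m).pow_const 2))
  refine hX.trans_eq ?_
  congr 2
  ext s
  simp

/-- The symmetrization argument: if every element of `B`, paired with a fresh sample, falls into
`A` with probability at least `p`, then `p * P(B) ≤ P(A)`. -/
theorem mul_measure_pi_le_of_ghost {𝒵 : Type*} [MeasurableSpace 𝒵] (P : Measure 𝒵)
    [IsProbabilityMeasure P] (n : ℕ) (p : ENNReal) {B : Set (Fin n → 𝒵)}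
    {A : Set (Fin n → 𝒵 × 𝒵)} (hA : NullMeasurableSet A (Measure.pi fun _ : Fin n => P.prod P))
    (h : ∀ s ∈ B, p ≤ (Measure.pi fun _ : Fin n => P) {s' | (fun i => (s i, s' i)) ∈ A}) :
    p * (Measure.pi fun _ : Fin n => P) B ≤ (Measure.pi fun _ : Fin n => P.prod P) A := by
  set μ := Measure.pi fun _ : Fin n => P
  have he := measurePreserving_arrowProdEquivProdArrow 𝒵 𝒵 (Fin n) (fun _ => P) (fun _ => P)
  set e := MeasurableEquiv.arrowProdEquivProdArrow 𝒵 𝒵 (Fin n)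
  -- `A` is only null measurable, so its sections may fail to be measurable; a measurable hull of
  -- the same measure takes its place.
  set M := toMeasurable (μ.prod μ) (e.symm ⁻¹' A)
  have hM : (μ.prod μ) M = (Measure.pi fun _ : Fin n => P.prod P) A := by
    rw [measure_toMeasurable]
    exact (he.symm e).measure_preimage hA
  have hMm : MeasurableSet M := measurableSet_toMeasurable _ _
  rw [← hM, Measure.prod_apply hMm]
  refine le_trans ?_ (mul_meas_ge_le_lintegral (measurable_measure_prodMk_left hMm) p)
  gcongr
  intro s hs
  refine (h s hs).trans (measure_mono fun s' hs' => ?_)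
  exact subset_toMeasurable _ _ hs'

/-- The relative deviation inequality for a class of functions with values in `[0, 1]` which has at
most `N` different restrictions to each double sample. -/
theorem measure_exists_relative_deviation_le {𝒵 Θ : Type*} [MeasurableSpace 𝒵] [MeasurableSpace Θ]
    [StandardBorelSpace Θ] (P : Measure 𝒵) [IsProbabilityMeasure P] {l : Θ → 𝒵 → ℝ}
    (hl : Measurable fun q : Θ × 𝒵 => l q.1 q.2) (h0 : ∀ θ z, 0 ≤ l θ z) (h1 : ∀ θ z, l θ z ≤ 1)
    (n N : ℕ) {L : ℝ} (hL : 1 ≤ L)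
    (hN : ∀ t : Fin n → 𝒵 × 𝒵, ∃ T : Finset Θ, T.card ≤ N ∧ ∀ θ, ∃ τ ∈ T, ∀ i,
      l θ (t i).1 = l τ (t i).1 ∧ l θ (t i).2 = l τ (t i).2) :
    (Measure.pi fun _ : Fin n => P) {s | ∃ q : Θ × Θ,
      8 * L + √(8 * L * ∑ i, |l q.1 (s i) - l q.2 (s i)|) <
        ∑ i, (l q.1 (s i) - l q.2 (s i)) - n * (∫ z, l q.1 z ∂P - ∫ z, l q.2 z ∂P)}
      ≤ ENNReal.ofReal (48 * (N ^ 2 * Real.exp (-L))) := by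
  classical
  set A : Set (Fin n → 𝒵 × 𝒵) := {t | ∃ q : Θ × Θ,
    2 * L + √(8 * L * ∑ i, |l q.1 (t i).1 - l q.2 (t i).1|) <
      ∑ i, ((l q.1 (t i).1 - l q.2 (t i).1) - (l q.1 (t i).2 - l q.2 (t i).2))} with hAdef
  have hlθ : ∀ θ, Measurable (l θ) := fun θ => hl.comp measurable_prodMk_left
  have hA : NullMeasurableSet A (Measure.pi fun _ : Fin n => P.prod P) := by
    refine nullMeasurableSet_exists _ (p := fun (q : Θ × Θ) (t : Fin n → 𝒵 × 𝒵) =>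
      2 * L + √(8 * L * ∑ i, |l q.1 (t i).1 - l q.2 (t i).1|) <
      ∑ i, ((l q.1 (t i).1 - l q.2 (t i).1) - (l q.1 (t i).2 - l q.2 (t i).2))) ?_
    have m : ∀ (f : (Θ × Θ) × (Fin n → 𝒵 × 𝒵) → Θ) (g : (Θ × Θ) × (Fin n → 𝒵 × 𝒵) → 𝒵),
        Measurable f → Measurable g → Measurable fun x => l (f x) (g x) :=
      fun f g hf hg => hl.comp (hf.prodMk hg)
    have m1 : ∀ i, Measurable fun x : (Θ × Θ) × (Fin n → 𝒵 × 𝒵) => l x.1.1 (x.2 i).1 :=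
      fun i => m _ _ (by fun_prop) (by fun_prop)
    have m2 : ∀ i, Measurable fun x : (Θ × Θ) × (Fin n → 𝒵 × 𝒵) => l x.1.2 (x.2 i).1 :=
      fun i => m _ _ (by fun_prop) (by fun_prop)
    have m3 : ∀ i, Measurable fun x : (Θ × Θ) × (Fin n → 𝒵 × 𝒵) => l x.1.1 (x.2 i).2 :=
      fun i => m _ _ (by fun_prop) (by fun_prop)
    have m4 : ∀ i, Measurable fun x : (Θ × Θ) × (Fin n → 𝒵 × 𝒵) => l x.1.2 (x.2 i).2 :=
      fun i => m _ _ (by fun_prop) (by fun_prop)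
    refine measurableSet_lt ?_ ?_
    · refine (Measurable.sqrt ((Finset.measurable_sum _ fun i _ => ?_).const_mul _)).const_add _
      exact measurable_abs.comp ((m1 i).sub (m2 i))
    · exact Finset.measurable_sum _ fun i _ => ((m1 i).sub (m2 i)).sub ((m3 i).sub (m4 i))
  have hAle : (Measure.pi fun _ : Fin n => P.prod P) A
      ≤ ENNReal.ofReal (2 * (N ^ 2 * Real.exp (-L))) := by
    refine measure_le_of_card_swapPairs_le P hA fun t => ?_
    obtain ⟨T, hT, hrep⟩ := hN t
    -- The positive part of a loss difference; the negative part is `f q.swap`. Treating them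
    -- separately gives one-sided bounds whose square roots can be expressed by the first sample
    -- alone, as the stated deviation requires.
    let f : Θ × Θ → 𝒵 → ℝ := fun q z => max (l q.1 z - l q.2 z) 0
    have hf0 : ∀ q z, 0 ≤ f q z := fun q z => le_max_right _ _
    have hf1 : ∀ q z, f q z ≤ 1 := fun q z => max_le (by linarith [h0 q.2 z, h1 q.1 z]) zero_le_one
    have hfsub : ∀ q z, l q.1 z - l q.2 z = f q z - f q.swap z := fun q z => by
      simp only [f, Prod.fst_swap, Prod.snd_swap]
      rcases le_total (l q.1 z) (l q.2 z) with h | h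
      · rw [max_eq_right (by linarith), max_eq_left (by linarith)]; ring
      · rw [max_eq_left (by linarith), max_eq_right (by linarith)]; ring
    have hfabs : ∀ q z, |l q.1 z - l q.2 z| = f q z + f q.swap z := fun q z => by
      simp only [f, Prod.fst_swap, Prod.snd_swap]
      rcases le_total (l q.1 z) (l q.2 z) with h | h
      · rw [max_eq_right (by linarith), max_eq_left (by linarith), abs_of_nonpos (by linarith)]
        ring
      · rw [max_eq_left (by linarith), max_eq_right (by linarith), abs_of_nonneg (by linarith)]
        ring
    let M : Θ × Θ → ℝ := fun q => ∑ i, (f q (t i).1 + f q (t i).2)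
    let d : Θ × Θ → Fin n → ℝ := fun q i => f q (t i).1 - f q (t i).2
    -- For numbers in `[0, 1]`, `(a - b) ^ 2 ≤ a + b`. The bound `M q` sums over both samples, so it
    -- does not change under exchanges.
    have hM : ∀ q, ∑ i, d q i ^ 2 ≤ M q := fun q => Finset.sum_le_sum fun i _ => by
      change (f q (t i).1 - f q (t i).2) ^ 2 ≤ _
      nlinarith [hf0 q (t i).1, hf0 q (t i).2, hf1 q (t i).1, hf1 q (t i).2,
        mul_nonneg (hf0 q (t i).1) (hf0 q (t i).2)]
    have hM' : ∀ q, ∑ i, (-d q i) ^ 2 ≤ M q := fun q => by simpa using hM q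
    let E1 : Θ × Θ → Finset (Fin n → Bool) := fun q =>
      Finset.univ.filter fun b => √(2 * L * M q) < ∑ i, sgn (b i) * d q i
    let E2 : Θ × Θ → Finset (Fin n → Bool) := fun q =>
      Finset.univ.filter fun b => √(2 * L * M q) < ∑ i, sgn (b i) * -d q i
    have hE1 : ∀ q, ((E1 q).card : ℝ) ≤ 2 ^ n * Real.exp (-L) := fun q => by
      simpa only [Fintype.card_fin] using card_signs_sum_gt_le (d q) (by linarith : 0 ≤ L) (hM q)
    have hE2 : ∀ q, ((E2 q).card : ℝ) ≤ 2 ^ n * Real.exp (-L) := fun q => by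
      simpa only [Fintype.card_fin] using
        card_signs_sum_gt_le (fun i => -d q i) (by linarith : 0 ≤ L) (hM' q)
    have hsub : ∀ b, swapPairs b t ∈ A → b ∈ (T ×ˢ T).biUnion fun q => E1 q ∪ E2 q.swap := by
      intro b hb
      by_contra hcon
      obtain ⟨⟨θ, θ'⟩, hq⟩ := hb
      obtain ⟨τ, hτ, hτe⟩ := hrep θ
      obtain ⟨τ', hτ', hτe'⟩ := hrep θ'
      have hsw : ∀ i, l θ (swapPairs b t i).1 = l τ (swapPairs b t i).1 ∧
          l θ (swapPairs b t i).2 = l τ (swapPairs b t i).2 ∧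
          l θ' (swapPairs b t i).1 = l τ' (swapPairs b t i).1 ∧
          l θ' (swapPairs b t i).2 = l τ' (swapPairs b t i).2 := fun i => by
        have a := hτe i
        have a' := hτe' i
        by_cases h : b i <;> simp [swapPairs, h, a.1, a.2, a'.1, a'.2]
      simp only [fun i => (hsw i).1, fun i => (hsw i).2.1, fun i => (hsw i).2.2.1,
        fun i => (hsw i).2.2.2] at hq
      set q : Θ × Θ := (τ, τ') with hqdef
      simp only [Finset.mem_biUnion, not_exists, not_and, Finset.mem_union, not_or] at hcon
      obtain ⟨c1, c2⟩ := hcon q (Finset.mk_mem_product hτ hτ')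
      simp only [E1, E2, Finset.mem_filter, Finset.mem_univ, true_and, not_lt] at c1 c2
      have hdiff : ∀ p i, f p (swapPairs b t i).1 - f p (swapPairs b t i).2 = sgn (b i) * d p i := by
        intro p i
        by_cases h : b i <;> simp [swapPairs, sgn, h, d]
      have hadd : ∀ p i, f p (swapPairs b t i).1 + f p (swapPairs b t i).2
          = f p (t i).1 + f p (t i).2 := by
        intro p i
        by_cases h : b i
        · simp [swapPairs, h]
        · simp [swapPairs, h, add_comm]
      have hadd' : ∀ p, ∑ i, f p (swapPairs b t i).1 + ∑ i, f p (swapPairs b t i).2 = M p := by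
        intro p
        rw [← Finset.sum_add_distrib]
        exact Finset.sum_congr rfl fun i _ => hadd p i
      have key := sub_add_sub_le_of_le_sqrt (a := ∑ i, f q (swapPairs b t i).1)
        (b := ∑ i, f q (swapPairs b t i).2) (c := ∑ i, f q.swap (swapPairs b t i).2)
        (e := ∑ i, f q.swap (swapPairs b t i).1) (κ := 2 * L)
        (Finset.sum_nonneg fun i _ => hf0 _ _)
        (Finset.sum_nonneg fun i _ => hf0 _ _) (Finset.sum_nonneg fun i _ => hf0 _ _)
        (by linarith) (by
          rw [hadd', ← Finset.sum_sub_distrib]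
          simpa only [hdiff] using c1) (by
          rw [add_comm (∑ i, f q.swap _), hadd', ← Finset.sum_sub_distrib]
          refine le_trans (le_of_eq (Finset.sum_congr rfl fun i _ => ?_)) c2
          rw [mul_neg, ← hdiff, neg_sub])
      refine absurd hq (not_lt.2 ?_)
      have g1 : ∑ i, (l τ (swapPairs b t i).1 - l τ' (swapPairs b t i).1 -
          (l τ (swapPairs b t i).2 - l τ' (swapPairs b t i).2))
          = (∑ i, f q (swapPairs b t i).1 - ∑ i, f q (swapPairs b t i).2) +
            (∑ i, f q.swap (swapPairs b t i).2 - ∑ i, f q.swap (swapPairs b t i).1) := by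
        rw [← Finset.sum_sub_distrib, ← Finset.sum_sub_distrib, ← Finset.sum_add_distrib]
        refine Finset.sum_congr rfl fun i _ => ?_
        have a1 := hfsub q (swapPairs b t i).1
        have a2 := hfsub q (swapPairs b t i).2
        simp only [hqdef] at a1 a2 ⊢
        rw [a1, a2]
        ring
      have g2 : ∑ i, |l τ (swapPairs b t i).1 - l τ' (swapPairs b t i).1|
          = ∑ i, f q (swapPairs b t i).1 + ∑ i, f q.swap (swapPairs b t i).1 := by
        rw [← Finset.sum_add_distrib]
        exact Finset.sum_congr rfl fun i _ => hfabs q _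
      rw [g1, g2, show 8 * L = 4 * (2 * L) by ring]
      exact key
    have hcard : Nat.card {b : Fin n → Bool // swapPairs b t ∈ A}
        ≤ ((T ×ˢ T).biUnion fun q => E1 q ∪ E2 q.swap).card := by
      rw [Nat.card_eq_fintype_card, Fintype.card_subtype]
      exact Finset.card_le_card fun b hb => hsub b (Finset.mem_filter.1 hb).2
    calc (Nat.card {b : Fin n → Bool // swapPairs b t ∈ A} : ℝ)
        ≤ (((T ×ˢ T).biUnion fun q => E1 q ∪ E2 q.swap).card : ℕ) := by exact_mod_cast hcard
      _ ≤ ((∑ q ∈ T ×ˢ T, (E1 q ∪ E2 q.swap).card : ℕ) : ℝ) := by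
          exact_mod_cast Finset.card_biUnion_le
      _ ≤ ∑ q ∈ T ×ˢ T, 2 * (2 ^ n * Real.exp (-L)) := by
          push_cast
          refine Finset.sum_le_sum fun q _ => ?_
          have : ((E1 q ∪ E2 q.swap).card : ℝ) ≤ (E1 q).card + (E2 q.swap).card := by
            exact_mod_cast Finset.card_union_le _ _
          linarith [hE1 q, hE2 q.swap]
      _ = (T.card : ℝ) ^ 2 * (2 * (2 ^ n * Real.exp (-L))) := by
          rw [Finset.sum_const, Finset.card_product, nsmul_eq_mul]; push_cast; ring
      _ ≤ (N : ℝ) ^ 2 * (2 * (2 ^ n * Real.exp (-L))) :=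
          mul_le_mul_of_nonneg_right (pow_le_pow_left₀ (Nat.cast_nonneg _) (Nat.cast_le.2 hT) 2)
            (by positivity)
      _ = 2 ^ Fintype.card (Fin n) * (2 * (N ^ 2 * Real.exp (-L))) := by
          rw [Fintype.card_fin]; ring
  have hghost := mul_measure_pi_le_of_ghost P n (ENNReal.ofReal (1 / 24)) (B := {s | ∃ q : Θ × Θ,
      8 * L + √(8 * L * ∑ i, |l q.1 (s i) - l q.2 (s i)|) <
        ∑ i, (l q.1 (s i) - l q.2 (s i)) - n * (∫ z, l q.1 z ∂P - ∫ z, l q.2 z ∂P)}) hA (by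
    rintro s ⟨q, hq⟩
    have hint : ∀ θ, Integrable (l θ) P := fun θ =>
      Integrable.of_bound (hlθ θ).aestronglyMeasurable 1 (Filter.Eventually.of_forall fun z => by
        rw [Real.norm_eq_abs, abs_of_nonneg (h0 θ z)]; exact h1 θ z)
    have h := le_pi_sum_sub_integral_le P n (g := fun z => l q.1 z - l q.2 z)
      ((hlθ q.1).sub (hlθ q.2)) (fun z => abs_le.2
        ⟨by linarith [h0 q.1 z, h1 q.2 z], by linarith [h1 q.1 z, h0 q.2 z]⟩)
    refine (ENNReal.ofReal_le_ofReal h).trans ?_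
    rw [ofReal_measureReal]
    refine measure_mono fun s' hs' => ⟨q, ?_⟩
    rw [integral_sub (hint _) (hint _), Set.mem_ofPred_eq] at hs'
    -- The ghost sample loses at most `6`, and `8 L - 6 ≥ 2 L` because `L ≥ 1`.
    simp only [Finset.sum_sub_distrib] at hq hs' ⊢
    linarith)
  have h3 := hghost.trans hAle
  have h4 : ENNReal.ofReal (2 * (N ^ 2 * Real.exp (-L)))
      = ENNReal.ofReal (1 / 24) * ENNReal.ofReal (48 * (N ^ 2 * Real.exp (-L))) := by
    rw [← ENNReal.ofReal_mul (by norm_num)]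
    congr 1; ring
  rw [h4] at h3
  exact (ENNReal.mul_le_mul_iff_right (ENNReal.ofReal_pos.2 (by norm_num)).ne'
    ENNReal.ofReal_ne_top).1 h3

/-! ## The growth function -/

/-- The binomial sum of the Sauer bound is at most `(2 e max(n, d) / d) ^ d`. -/
theorem sum_choose_le_pow (n d : ℕ) :
    ((∑ k ∈ Finset.Iic d, (2 * n).choose k : ℕ) : ℝ)
      ≤ (2 * Real.exp 1 * (max n d : ℕ) / d) ^ d := by
  rcases Nat.eq_zero_or_pos d with rfl | hd
  · have : Finset.Iic 0 = {0} := rfl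
    simp [this]
  have hd' : (0 : ℝ) < d := by exact_mod_cast hd
  rcases le_or_gt d n with h | h
  · rw [max_eq_left h]
    have hn : (0 : ℝ) < n := by exact_mod_cast hd.trans_le h
    -- Since `x ≤ 1`, weighting the `k`-th coefficient by `x ^ k` costs at most a factor `x ^ d` for
    -- `k ≤ d`, and the full weighted sum is `(1 + x) ^ (2 n) ≤ exp d`.
    set x : ℝ := d / (2 * n)
    have hx0 : 0 < x := by positivity
    have hx1 : x ≤ 1 := by
      rw [div_le_one (by positivity)]
      have : (d : ℝ) ≤ n := by exact_mod_cast h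
      linarith
    have h1 : x ^ d * ((∑ k ∈ Finset.Iic d, (2 * n).choose k : ℕ) : ℝ) ≤ Real.exp d := by
      calc x ^ d * ((∑ k ∈ Finset.Iic d, (2 * n).choose k : ℕ) : ℝ)
          ≤ ∑ k ∈ Finset.Iic d, x ^ k * ((2 * n).choose k : ℝ) := by
            push_cast
            rw [Finset.mul_sum]
            refine Finset.sum_le_sum fun k hk => ?_
            exact mul_le_mul_of_nonneg_right
              (pow_le_pow_of_le_one hx0.le hx1 (Finset.mem_Iic.1 hk)) (Nat.cast_nonneg _)
        _ ≤ ∑ k ∈ Finset.range (2 * n + 1), x ^ k * ((2 * n).choose k : ℝ) := by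
            refine Finset.sum_le_sum_of_subset_of_nonneg (fun k hk => ?_) fun k _ _ => by positivity
            have := Finset.mem_Iic.1 hk
            exact Finset.mem_range.2 (by omega)
        _ = (x + 1) ^ (2 * n) := by
            rw [add_pow]
            simp
        _ ≤ Real.exp x ^ (2 * n) := by
            gcongr
            exact Real.add_one_le_exp x
        _ = Real.exp d := by
            rw [← Real.exp_nat_mul]
            congr 1
            simp only [x]
            push_cast
            field_simp
    have h2 : (2 * Real.exp 1 * n / d) ^ d = Real.exp d / x ^ d := by
      rw [show (2 * Real.exp 1 * n / d : ℝ) = Real.exp 1 / x by simp only [x]; field_simp, div_pow,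
        ← Real.exp_nat_mul, mul_one]
    rw [h2, le_div_iff₀ (by positivity), mul_comm]
    exact h1
  · rw [max_eq_right h.le, mul_div_assoc, div_self hd'.ne', mul_one]
    have h1 : ∑ k ∈ Finset.Iic d, (2 * n).choose k ≤ 4 ^ d := by
      calc ∑ k ∈ Finset.Iic d, (2 * n).choose k
          ≤ ∑ k ∈ Finset.range (2 * d + 1), (2 * d).choose k :=
            (Finset.sum_le_sum fun k _ => Nat.choose_le_choose k (by omega)).trans
              (Finset.sum_le_sum_of_subset fun k hk => by
                have := Finset.mem_Iic.1 hk
                exact Finset.mem_range.2 (by omega))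
        _ = 4 ^ d := by rw [Nat.sum_range_choose, pow_mul]; norm_num
    have h2 : (4 : ℝ) ≤ 2 * Real.exp 1 := by
      have := Real.add_one_le_exp (1 : ℝ)
      linarith
    calc ((∑ k ∈ Finset.Iic d, (2 * n).choose k : ℕ) : ℝ) ≤ 4 ^ d := by exact_mod_cast h1
      _ ≤ (2 * Real.exp 1) ^ d := by gcongr

/-- The Sauer–Shelah lemma for a parametrized class: on `m` points the classifiers are represented
by at most `∑ k ≤ d, m.choose k` parameters. -/
theorem exists_representatives {X Θ ι : Type*} [Fintype ι] {f : Θ → X → Bool} {d : ℕ}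
    (hd : HasVCDim (Set.range f) d) (x : ι → X) :
    ∃ T : Finset Θ, T.card ≤ ∑ k ∈ Finset.Iic d, (Fintype.card ι).choose k ∧
      ∀ θ, ∃ τ ∈ T, ∀ i, f θ (x i) = f τ (x i) := by
  classical
  let pat : Θ → Finset ι := fun θ => Finset.univ.filter fun i => f θ (x i) = true
  let 𝒜 : Finset (Finset ι) := Finset.univ.filter fun A => ∃ θ, pat θ = A
  have hsh : ∀ A, 𝒜.Shatters A → A.card ≤ d := by
    intro A hA
    -- The points may repeat. A shattered index set cannot contain two indices of the same point,
    -- since a pattern separating them is impossible; hence its image is a shattered set of equal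
    -- size.
    have hinj : Set.InjOn x A := by
      intro i hi j hj hij
      by_contra hne
      obtain ⟨u, hu, hui⟩ := hA (Finset.singleton_subset_iff.2 hi)
      obtain ⟨θ, rfl⟩ := (Finset.mem_filter.1 hu).2
      have h1 : i ∈ A ∩ pat θ := by rw [hui]; exact Finset.mem_singleton_self i
      have h2 : j ∈ A ∩ pat θ := by
        simp only [pat, Finset.mem_inter, Finset.mem_filter, Finset.mem_univ, true_and] at h1 ⊢
        exact ⟨hj, hij ▸ h1.2⟩
      rw [hui, Finset.mem_singleton] at h2
      exact hne h2.symm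
    rw [← Finset.card_image_of_injOn hinj]
    refine hd.2 _ fun b => ?_
    obtain ⟨u, hu, hui⟩ := hA (Finset.filter_subset (fun i => b (x i) = true) A)
    obtain ⟨θ, rfl⟩ := (Finset.mem_filter.1 hu).2
    refine ⟨f θ, ⟨θ, rfl⟩, fun y hy => ?_⟩
    obtain ⟨i, hi, rfl⟩ := Finset.mem_image.1 hy
    have := Finset.ext_iff.1 hui i
    simp only [pat, Finset.mem_inter, Finset.mem_filter, Finset.mem_univ, true_and, hi] at this
    exact Bool.eq_iff_iff.2 this
  have hcard : 𝒜.card ≤ ∑ k ∈ Finset.Iic d, (Fintype.card ι).choose k := by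
    refine (Finset.card_le_card_shatterer 𝒜).trans
      (Finset.card_shatterer_le_sum_vcDim.trans (Finset.sum_le_sum_of_subset ?_))
    refine Finset.Iic_subset_Iic.2 (Finset.sup_le fun A hA => hsh A (Finset.mem_shatterer.1 hA))
  have hex : ∀ A ∈ 𝒜, ∃ θ, pat θ = A := fun A hA => (Finset.mem_filter.1 hA).2
  have hΘ : Nonempty Θ := by
    obtain ⟨⟨s, -, hs⟩, -⟩ := hd
    obtain ⟨_, ⟨θ, -⟩, -⟩ := hs fun _ => true
    exact ⟨θ⟩
  choose! g hg using hex
  refine ⟨𝒜.image g, Finset.card_image_le.trans hcard, fun θ => ?_⟩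
  have hθ : pat θ ∈ 𝒜 := Finset.mem_filter.2 ⟨Finset.mem_univ _, θ, rfl⟩
  refine ⟨g (pat θ), Finset.mem_image_of_mem g hθ, fun i => ?_⟩
  have := Finset.ext_iff.1 (hg _ hθ) i
  simp only [pat, Finset.mem_filter, Finset.mem_univ, true_and] at this
  exact (Bool.eq_iff_iff.2 this).symm

/-- The samples on which two classifiers of `H` deviate: `c z b` is the loss on `z` of predicting the
label `b` at the instance `x z`, and the empirical mean of a difference of losses exceeds its
expectation by more than `σ + √(σ ρ)`. -/
def relDev {X 𝒵 : Type*} [MeasurableSpace 𝒵] (H : Set (X → Bool)) (x : 𝒵 → X) (c : 𝒵 → Bool → ℝ)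
    (σ : ℝ) (n : ℕ) (P : Measure 𝒵) : Set (Fin n → 𝒵) :=
  {s | ∃ h ∈ H, ∃ g ∈ H,
    σ + √(σ * ((∑ i, |c (s i) (h (x (s i))) - c (s i) (g (x (s i)))|) / n)) <
      (∑ i, (c (s i) (h (x (s i))) - c (s i) (g (x (s i))))) / n -
        (∫ z, c z (h (x z)) ∂P - ∫ z, c z (g (x z)) ∂P)}

theorem measurable_loss {X 𝒵 Θ : Type*} [MeasurableSpace X] [MeasurableSpace 𝒵]
    [MeasurableSpace Θ] {f : Θ → X → Bool} (hf : Measurable fun p : Θ × X => f p.1 p.2)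
    {x : 𝒵 → X} (hx : Measurable x) {c : 𝒵 → Bool → ℝ} (hc : ∀ b, Measurable fun z => c z b) :
    Measurable fun q : Θ × 𝒵 => c q.2 (f q.1 (x q.2)) := by
  have h1 : Measurable fun q : Θ × 𝒵 => f q.1 (x q.2) :=
    hf.comp (measurable_fst.prodMk (hx.comp measurable_snd))
  have : (fun q : Θ × 𝒵 => c q.2 (f q.1 (x q.2)))
      = fun q => if f q.1 (x q.2) = true then c q.2 true else c q.2 false := by
    ext q
    cases f q.1 (x q.2) <;> simp
  rw [this]
  exact Measurable.ite (h1 (measurableSet_singleton true)) ((hc true).comp measurable_snd)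
    ((hc false).comp measurable_snd)

/-- The relative deviation inequality for a VC class. -/
theorem measure_relDev_le {X 𝒵 : Type*} [MeasurableSpace X] [MeasurableSpace 𝒵]
    {H : Set (X → Bool)} {d : ℕ} (hadm : Admissible H) (hd : HasVCDim H d) (P : Measure 𝒵)
    [IsProbabilityMeasure P] {x : 𝒵 → X} (hx : Measurable x) {c : 𝒵 → Bool → ℝ}
    (hc : ∀ b, Measurable fun z => c z b) (h0 : ∀ z b, 0 ≤ c z b) (h1 : ∀ z b, c z b ≤ 1)
    {n : ℕ} (hn : 0 < n) {δ : ℝ} (hδ : 0 < δ) (hδ1 : δ ≤ 1) :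
    (Measure.pi fun _ : Fin n => P) (relDev H x c (sigma d n δ) n P) ≤ ENNReal.ofReal (2 * δ) := by
  obtain ⟨Θ, _, _, f, hf, rfl⟩ := hadm
  set y : ℝ := 2 * Real.exp 1 * (max n d : ℕ) / d with hy
  -- Chosen so that `exp (-L) = δ / (24 y ^ (2 d))`: the factor `y ^ (2 d)` absorbs the squared
  -- growth function (pairs of classifiers), and `48 / 24` leaves `2 δ`. For `d = 0` the junk value
  -- of `y` is harmless, as `y ^ 0 = 1`.
  set L : ℝ := 2 * d * Real.log y + Real.log (24 / δ) with hLdef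
  have hn' : (0 : ℝ) < n := by exact_mod_cast hn
  have he : (1 : ℝ) ≤ 2 * Real.exp 1 := by linarith [Real.add_one_le_exp (1 : ℝ)]
  have hy1 : 0 < d → 1 ≤ y := fun hd0 => by
    have hd' : (0 : ℝ) < d := by exact_mod_cast hd0
    rw [hy, le_div_iff₀ hd', one_mul]
    have : (d : ℝ) ≤ (max n d : ℕ) := by exact_mod_cast le_max_right n d
    nlinarith
  have hlog : 0 ≤ 2 * d * Real.log y := by
    rcases Nat.eq_zero_or_pos d with h | h
    · simp [h]
    · have := Real.log_nonneg (hy1 h)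
      positivity
  have hL : 1 ≤ L := by
    have : 1 ≤ Real.log (24 / δ) := by
      rw [Real.le_log_iff_exp_le (by positivity), le_div_iff₀ hδ]
      nlinarith [Real.exp_one_lt_d9, Real.exp_pos 1]
    linarith
  have hyd : Real.exp (2 * d * Real.log y) = (y ^ d) ^ 2 := by
    rcases Nat.eq_zero_or_pos d with h | h
    · simp [h]
    · rw [mul_comm, Real.exp_mul, Real.exp_log (by linarith [hy1 h]), ← pow_mul]
      exact_mod_cast (Real.rpow_natCast y (2 * d)).trans (by rw [mul_comm])
  have hexp : Real.exp (-L) = δ / 24 / (y ^ d) ^ 2 := by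
    rw [hLdef, neg_add, Real.exp_add, Real.exp_neg, Real.exp_neg, hyd,
      Real.exp_log (by positivity)]
    field_simp
  have hyd0 : 0 < y ^ d := by
    rcases Nat.eq_zero_or_pos d with h | h
    · simp [h]
    · have := hy1 h
      positivity
  have key := measure_exists_relative_deviation_le P (l := fun θ z => c z (f θ (x z)))
    (measurable_loss hf hx hc) (fun _ _ => h0 _ _) (fun _ _ => h1 _ _) n
    (∑ k ∈ Finset.Iic d, (2 * n).choose k) hL (by
      intro t
      obtain ⟨T, hT, hrep⟩ := exists_representatives hd
        (fun i : Fin n × Bool => if i.2 then x (t i.1).1 else x (t i.1).2)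
      refine ⟨T, by simpa [mul_comm] using hT, fun θ => ?_⟩
      obtain ⟨τ, hτ, hτe⟩ := hrep θ
      refine ⟨τ, hτ, fun i => ?_⟩
      have a1 := hτe (i, true)
      have a2 := hτe (i, false)
      simp only [if_true, Bool.false_eq_true, if_false] at a1 a2
      rw [a1, a2]
      exact ⟨rfl, rfl⟩)
  refine (measure_mono ?_).trans (key.trans (ENNReal.ofReal_le_ofReal ?_))
  · rintro s ⟨_, ⟨θ, rfl⟩, _, ⟨θ', rfl⟩, hs⟩
    refine ⟨(θ, θ'), ?_⟩
    have hσ : sigma d n δ = 8 * L / n := by rw [sigma]; ring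
    rw [hσ] at hs
    have hmul := mul_lt_mul_of_pos_left hs hn'
    set R := ∑ i, |c (s i) (f θ (x (s i))) - c (s i) (f θ' (x (s i)))|
    have hsq : n * √(8 * L / n * (R / n)) = √(8 * L * R) := by
      rw [show 8 * L / n * (R / n) = 8 * L * R / (n : ℝ) ^ 2 by field_simp,
        Real.sqrt_div' _ (by positivity), Real.sqrt_sq hn'.le]
      field_simp
    have hL8 : (n : ℝ) * (8 * L / n) = 8 * L := by field_simp
    rw [mul_add, hsq, hL8, mul_sub, mul_div_cancel₀ _ hn'.ne'] at hmul
    exact hmul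
  · rw [hexp]
    have h2 := pow_le_pow_left₀ (Nat.cast_nonneg _) (sum_choose_le_pow n d) 2
    calc 48 * (((∑ k ∈ Finset.Iic d, (2 * n).choose k : ℕ) : ℝ) ^ 2 * (δ / 24 / (y ^ d) ^ 2))
        ≤ 48 * ((y ^ d) ^ 2 * (δ / 24 / (y ^ d) ^ 2)) := by gcongr
      _ = 2 * δ := by field_simp; norm_num

/-! ## Conditionally i.i.d. samples -/

/-- The law of `n` independent draws from a Markov kernel. -/
noncomputable def piKernel {W 𝒵 : Type*} [MeasurableSpace W] [MeasurableSpace 𝒵] (κ : Kernel W 𝒵)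
    [IsMarkovKernel κ] (n : ℕ) : Kernel W (Fin n → 𝒵) where
  toFun w := Measure.pi fun _ => κ w
  measurable' := by
    refine Measurable.measure_of_isPiSystem_of_isProbabilityMeasure generateFrom_pi.symm
      isPiSystem_pi ?_
    rintro _ ⟨B, hB, rfl⟩
    simp only [Measure.pi_pi]
    exact Finset.measurable_prod _ fun i _ => κ.measurable_coe (hB i (Set.mem_univ i))

theorem piKernel_apply {W 𝒵 : Type*} [MeasurableSpace W] [MeasurableSpace 𝒵] (κ : Kernel W 𝒵)
    [IsMarkovKernel κ] (n : ℕ) (w : W) : piKernel κ n w = Measure.pi fun _ => κ w := rfl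

instance {W 𝒵 : Type*} [MeasurableSpace W] [MeasurableSpace 𝒵] (κ : Kernel W 𝒵)
    [IsMarkovKernel κ] (n : ℕ) : IsMarkovKernel (piKernel κ n) :=
  ⟨fun w => by rw [piKernel_apply]; infer_instance⟩

/-- The joint law of `w` and a sample which is conditionally i.i.d. with law `κ w`. -/
theorem map_prodMk_eq_compProd {Ω W 𝒵 : Type*} [MeasurableSpace Ω] [MeasurableSpace W]
    [MeasurableSpace 𝒵] {μ : Measure Ω} [IsProbabilityMeasure μ] (κ : Kernel W 𝒵)
    [IsMarkovKernel κ] {n : ℕ} {w : Ω → W} (hw : Measurable w) {s : Ω → Fin n → 𝒵}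
    (hs : Measurable s)
    (hlaw : ∀ C, MeasurableSet C → ∀ B : Fin n → Set 𝒵, (∀ i, MeasurableSet (B i)) →
      μ (w ⁻¹' C ∩ {ω | ∀ i, s ω i ∈ B i}) = ∫⁻ ω in w ⁻¹' C, ∏ i, κ (w ω) (B i) ∂μ) :
    μ.map (fun ω => (w ω, s ω)) = (μ.map w) ⊗ₘ piKernel κ n := by
  have : IsProbabilityMeasure (μ.map w) := Measure.isProbabilityMeasure_map hw.aemeasurable
  have : IsProbabilityMeasure (μ.map fun ω => (w ω, s ω)) :=
    Measure.isProbabilityMeasure_map (hw.prodMk hs).aemeasurable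
  refine Measure.ext_prod fun {C T} hC hT => ?_
  rw [Measure.map_apply (hw.prodMk hs) (hC.prod hT), Measure.compProd_apply_prod hC hT,
    setLIntegral_map hC ((piKernel κ n).measurable_coe hT) hw]
  -- For fixed `C` both sides are finite measures in the sample set. The hypothesis identifies them
  -- on boxes, which form a generating π-system.
  let m₁ : Measure (Fin n → 𝒵) := (μ.restrict (w ⁻¹' C)).map s
  let m₂ : Measure (Fin n → 𝒵) := (μ.restrict (w ⁻¹' C)).bind fun ω => piKernel κ n (w ω)
  have hκw : Measurable fun ω => piKernel κ n (w ω) := (piKernel κ n).measurable.comp hw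
  have hm₁ : ∀ T, MeasurableSet T → m₁ T = μ (w ⁻¹' C ∩ s ⁻¹' T) := fun T hT => by
    rw [Measure.map_apply hs hT, Measure.restrict_apply (hs hT), Set.inter_comm]
  have hm₂ : ∀ T, MeasurableSet T → m₂ T = ∫⁻ ω in w ⁻¹' C, piKernel κ n (w ω) T ∂μ :=
    fun T hT => Measure.bind_apply hT hκw.aemeasurable
  have heq : m₁ = m₂ := by
    refine ext_of_generate_finite _ generateFrom_pi.symm isPiSystem_pi ?_ ?_
    · rintro _ ⟨B, hB, rfl⟩
      have hB' : ∀ i, MeasurableSet (B i) := fun i => hB i (Set.mem_univ i)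
      have hBm := MeasurableSet.univ_pi hB'
      rw [hm₁ _ hBm, hm₂ _ hBm]
      simp only [piKernel_apply, Measure.pi_pi]
      rw [← hlaw C hC B hB']
      congr 2
      ext ω
      simp
    · rw [hm₁ _ MeasurableSet.univ, hm₂ _ MeasurableSet.univ]
      simp
  have h := congrArg (fun m => m T) heq
  simp only [hm₁ T hT, hm₂ T hT] at h
  exact h

/-- The relative deviation inequality for a conditionally i.i.d. sample. -/
theorem measure_inter_relDev_le {Ω W X 𝒵 : Type*} [MeasurableSpace Ω] [MeasurableSpace W]
    [MeasurableSpace X] [MeasurableSpace 𝒵] {μ : Measure Ω} [IsProbabilityMeasure μ]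
    (κ : Kernel W 𝒵) [IsMarkovKernel κ] {n : ℕ} (hn : 0 < n) {w : Ω → W} (hw : Measurable w)
    {s : Ω → Fin n → 𝒵} (hs : Measurable s)
    (hlaw : ∀ C, MeasurableSet C → ∀ B : Fin n → Set 𝒵, (∀ i, MeasurableSet (B i)) →
      μ (w ⁻¹' C ∩ {ω | ∀ i, s ω i ∈ B i}) = ∫⁻ ω in w ⁻¹' C, ∏ i, κ (w ω) (B i) ∂μ)
    {H : Set (X → Bool)} {d : ℕ} (hadm : Admissible H) (hd : HasVCDim H d)
    {x : 𝒵 → X} (hx : Measurable x) {c : 𝒵 → Bool → ℝ}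
    (hc : ∀ b, Measurable fun z => c z b) (h0 : ∀ z b, 0 ≤ c z b) (h1 : ∀ z b, c z b ≤ 1)
    {δ : ℝ} (hδ : 0 < δ) (hδ1 : δ ≤ 1) {C : Set W} (hC : MeasurableSet C) :
    μ {ω | w ω ∈ C ∧ s ω ∈ relDev H x c (sigma d n δ) n (κ (w ω))}
      ≤ ENNReal.ofReal (2 * δ) * μ (w ⁻¹' C) := by
  have : IsProbabilityMeasure (μ.map w) := Measure.isProbabilityMeasure_map hw.aemeasurable
  set G : Set (W × (Fin n → 𝒵)) :=
    {p | p.1 ∈ C ∧ p.2 ∈ relDev H x c (sigma d n δ) n (κ p.1)} with hG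
  have hGm : NullMeasurableSet G ((μ.map w) ⊗ₘ piKernel κ n) := by
    suffices h : NullMeasurableSet
        {p : W × (Fin n → 𝒵) | p.2 ∈ relDev H x c (sigma d n δ) n (κ p.1)}
        ((μ.map w) ⊗ₘ piKernel κ n) from (measurable_fst hC).nullMeasurableSet.inter h
    obtain ⟨Θ, _, _, f, hf, rfl⟩ := hadm
    have hset : {p : W × (Fin n → 𝒵) | p.2 ∈ relDev (Set.range f) x c (sigma d n δ) n (κ p.1)}
        = {p | ∃ q : Θ × Θ, sigma d n δ + √(sigma d n δ *
            ((∑ i, |c (p.2 i) (f q.1 (x (p.2 i))) - c (p.2 i) (f q.2 (x (p.2 i)))|) / n)) <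
          (∑ i, (c (p.2 i) (f q.1 (x (p.2 i))) - c (p.2 i) (f q.2 (x (p.2 i))))) / n -
          (∫ z, c z (f q.1 (x z)) ∂(κ p.1) - ∫ z, c z (f q.2 (x z)) ∂(κ p.1))} := by
      ext p
      constructor
      · rintro ⟨_, ⟨θ, rfl⟩, _, ⟨θ', rfl⟩, h⟩
        exact ⟨(θ, θ'), h⟩
      · rintro ⟨⟨θ, θ'⟩, h⟩
        exact ⟨_, ⟨θ, rfl⟩, _, ⟨θ', rfl⟩, h⟩
    rw [hset]
    refine nullMeasurableSet_exists _ (p := fun (q : Θ × Θ) (p : W × (Fin n → 𝒵)) =>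
      sigma d n δ + √(sigma d n δ *
            ((∑ i, |c (p.2 i) (f q.1 (x (p.2 i))) - c (p.2 i) (f q.2 (x (p.2 i)))|) / n)) <
          (∑ i, (c (p.2 i) (f q.1 (x (p.2 i))) - c (p.2 i) (f q.2 (x (p.2 i))))) / n -
          (∫ z, c z (f q.1 (x z)) ∂(κ p.1) - ∫ z, c z (f q.2 (x z)) ∂(κ p.1))) ?_
    have hl := measurable_loss hf hx hc
    have m1 : ∀ i, Measurable fun y : (Θ × Θ) × (W × (Fin n → 𝒵)) =>
        c (y.2.2 i) (f y.1.1 (x (y.2.2 i))) := fun i =>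
      hl.comp (g := fun q : Θ × 𝒵 => c q.2 (f q.1 (x q.2)))
        (f := fun y : (Θ × Θ) × (W × (Fin n → 𝒵)) => (y.1.1, y.2.2 i)) (by fun_prop)
    have m2 : ∀ i, Measurable fun y : (Θ × Θ) × (W × (Fin n → 𝒵)) =>
        c (y.2.2 i) (f y.1.2 (x (y.2.2 i))) := fun i =>
      hl.comp (g := fun q : Θ × 𝒵 => c q.2 (f q.1 (x q.2)))
        (f := fun y : (Θ × Θ) × (W × (Fin n → 𝒵)) => (y.1.2, y.2.2 i)) (by fun_prop)
    have m3 : Measurable fun y : Θ × W => ∫ z, c z (f y.1 (x z)) ∂(κ y.2) := by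
      have := StronglyMeasurable.integral_kernel_prod_right (κ := Kernel.prodMkLeft Θ κ)
        (f := fun (y : Θ × W) z => c z (f y.1 (x z)))
        (Measurable.stronglyMeasurable (hl.comp (g := fun q : Θ × 𝒵 => c q.2 (f q.1 (x q.2)))
          (f := fun y : (Θ × W) × 𝒵 => (y.1.1, y.2)) (by fun_prop)))
      exact this.measurable
    refine measurableSet_lt ?_ ?_
    · refine (Measurable.sqrt (((Finset.measurable_sum _ fun i _ => ?_).div_const _).const_mul
        _)).const_add _
      exact measurable_abs.comp ((m1 i).sub (m2 i))
    · refine ((Finset.measurable_sum _ fun i _ => (m1 i).sub (m2 i)).div_const _).sub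
        (Measurable.sub ?_ ?_)
      · exact m3.comp (f := fun y : (Θ × Θ) × (W × (Fin n → 𝒵)) => (y.1.1, y.2.1)) (by fun_prop)
      · exact m3.comp (f := fun y : (Θ × Θ) × (W × (Fin n → 𝒵)) => (y.1.2, y.2.1)) (by fun_prop)
  -- A measurable subset, rather than a hull: every section of `G'` then lies in a deviation event,
  -- so the unconditional inequality bounds it for every value of `w`, not just almost every one.
  obtain ⟨G', hG'G, hG'm, hG'e⟩ := hGm.exists_measurable_subset_ae_eq
  have hmap := map_prodMk_eq_compProd κ hw hs hlaw
  calc μ {ω | w ω ∈ C ∧ s ω ∈ relDev H x c (sigma d n δ) n (κ (w ω))}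
      ≤ μ.map (fun ω => (w ω, s ω)) G := Measure.le_map_apply (hw.prodMk hs).aemeasurable G
    _ = ∫⁻ v, piKernel κ n v (Prod.mk v ⁻¹' G') ∂(μ.map w) := by
        rw [hmap, ← measure_congr hG'e, Measure.compProd_apply hG'm]
    _ ≤ ∫⁻ v, C.indicator (fun _ => ENNReal.ofReal (2 * δ)) v ∂(μ.map w) := by
        refine lintegral_mono fun v => ?_
        change piKernel κ n v (Prod.mk v ⁻¹' G') ≤ _
        by_cases hv : v ∈ C
        · rw [Set.indicator_of_mem hv, piKernel_apply]
          refine (measure_mono fun t ht => ?_).trans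
            (measure_relDev_le hadm hd (κ v) hx hc h0 h1 hn hδ hδ1)
          exact (hG'G ht).2
        · have : Prod.mk v ⁻¹' G' = ∅ := by
            ext t
            simp only [Set.mem_preimage, Set.mem_empty_iff_false, iff_false]
            exact fun ht => hv (hG'G ht).1
          rw [this, measure_empty]
          exact zero_le
    _ = ENNReal.ofReal (2 * δ) * μ (w ⁻¹' C) := by
        rw [lintegral_indicator_const hC, Measure.map_apply hw hC]

/-! ## Errors under the law of a query -/

/-- The zero-one loss of predicting `b` on the labelled example `p`. -/
noncomputable def zeroOne {X : Type*} (p : X × Bool) (b : Bool) : ℝ := if b ≠ p.2 then 1 else 0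

theorem sum_zeroOne_div {X : Type*} {n : ℕ} (s : Fin n → X × Bool) (h : X → Bool) :
    (∑ i, zeroOne (s i) (h (s i).1)) / n = empErr s h := by
  simp only [empErr, zeroOne, Finset.card_filter]
  push_cast
  rfl

/-- Labels are binary, so where two classifiers disagree exactly one of them errs. The generic loss
distance in `relDev` therefore becomes the disagreement used by the algorithm. -/
theorem sum_abs_zeroOne_sub_div {X : Type*} {n : ℕ} (s : Fin n → X × Bool) (h g : X → Bool) :
    (∑ i, |zeroOne (s i) (h (s i).1) - zeroOne (s i) (g (s i).1)|) / n = empDis s h g := by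
  simp only [empDis, Finset.card_filter]
  push_cast
  congr 1
  refine Finset.sum_congr rfl fun i _ => ?_
  simp only [zeroOne]
  cases h (s i).1 <;> cases g (s i).1 <;> cases (s i).2 <;> simp

section Label

variable {X : Type*} [MeasurableSpace X] (D : Measure (X × Bool)) [IsProbabilityMeasure D]

/-- The conditional probability, given the instance `x`, that the label differs from `b`. -/
noncomputable def labelErr (x : X) (b : Bool) : ℝ := (D.condKernel x).real {y | b ≠ y}

theorem labelErr_nonneg (x : X) (b : Bool) : 0 ≤ labelErr D x b := measureReal_nonneg

theorem labelErr_le_one (x : X) (b : Bool) : labelErr D x b ≤ 1 := measureReal_le_one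

theorem measurable_labelErr (b : Bool) : Measurable fun x => labelErr D x b :=
  (D.condKernel.measurable_coe (MeasurableSet.of_discrete)).ennreal_toReal

theorem measurable_zeroOne (b : Bool) : Measurable fun p : X × Bool => zeroOne p b :=
  (measurable_of_finite fun y : Bool => if b ≠ y then (1 : ℝ) else 0).comp measurable_snd

theorem measurableSet_error {h : X → Bool} (hh : Measurable h) :
    MeasurableSet {p : X × Bool | h p.1 ≠ p.2} :=
  (measurableSet_eq_fun (hh.comp measurable_fst) measurable_snd).compl

theorem integral_zeroOne {h : X → Bool} (hh : Measurable h) (Q : Measure (X × Bool)) :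
    ∫ p, zeroOne p (h p.1) ∂Q = err Q h := by
  rw [err, ← integral_indicator_one (measurableSet_error hh)]
  congr 1
  ext p
  simp [zeroOne, Set.indicator_apply]

/-- Disintegration of `D`. It allows the unlabelled sample to control errors: the analysis uses the
`[0, 1]`-valued loss `labelErr`, although no label is seen. -/
theorem integral_labelErr {h : X → Bool} (hh : Measurable h) :
    ∫ x, labelErr D x (h x) ∂D.fst = err D h := by
  have hm : Measurable fun x => D.condKernel x {y | h x ≠ y} :=
    Kernel.measurable_kernel_prodMk_left (measurableSet_error hh)
  rw [err, Measure.real]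
  conv_rhs => rw [← D.disintegrate D.condKernel, Measure.compProd_apply (measurableSet_error hh)]
  exact integral_toReal hm.aemeasurable (Filter.Eventually.of_forall fun x => measure_lt_top _ _)

/-- Outside of the deviation event, differences of empirical errors are close to differences of
errors. -/
theorem empErr_sub_le_of_notMem_relDev {H : Set (X → Bool)} (hH : ∀ h ∈ H, Measurable h) {σ : ℝ}
    {n : ℕ} {Q : Measure (X × Bool)} {s : Fin n → X × Bool}
    (hs : s ∉ relDev H Prod.fst zeroOne σ n Q) {h g : X → Bool} (hh : h ∈ H) (hg : g ∈ H) :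
    (empErr s h - empErr s g) - (err Q h - err Q g) ≤ σ + √(σ * empDis s h g) := by
  by_contra hcon
  refine hs ⟨h, hh, g, hg, ?_⟩
  rw [sum_abs_zeroOne_sub_div, integral_zeroOne (hH h hh), integral_zeroOne (hH g hg),
    Finset.sum_sub_distrib, sub_div, sum_zeroOne_div, sum_zeroOne_div]
  exact not_le.1 hcon

theorem queryLaw_apply {n : ℕ} (z : Fin n → X) {γ : Fin n → ℝ} (hγ : ∑ i, γ i ≠ 0)
    {B : Set (X × Bool)} (hB : MeasurableSet B) :
    queryLaw D z γ B
      = ∑ i, ENNReal.ofReal (γ i / ∑ l, γ l) * D.condKernel (z i) (Prod.mk (z i) ⁻¹' B) := by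
  rw [queryLaw, if_neg hγ, Measure.finsetSum_apply]
  refine Finset.sum_congr rfl fun i _ => ?_
  rw [Measure.smul_apply, smul_eq_mul, Measure.map_apply measurable_prodMk_left hB]

theorem isProbabilityMeasure_queryLaw {n : ℕ} (z : Fin n → X) {γ : Fin n → ℝ}
    (hγ : ∀ i, 0 ≤ γ i) : IsProbabilityMeasure (queryLaw D z γ) := by
  by_cases h : ∑ i, γ i = 0
  · rw [queryLaw, if_pos h]; infer_instance
  · constructor
    have hpos : 0 ≤ ∑ i, γ i := Finset.sum_nonneg fun i _ => hγ i
    rw [queryLaw_apply D z h MeasurableSet.univ]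
    simp only [Set.preimage_univ, measure_univ, mul_one]
    rw [← ENNReal.ofReal_sum_of_nonneg fun i _ => div_nonneg (hγ i) hpos, ← Finset.sum_div,
      div_self h, ENNReal.ofReal_one]

/-- After multiplication by `φ_k` the normalization cancels, and the query error becomes the
`γ`-weighted part of the error on the unlabelled sample. -/
theorem err_queryLaw {n : ℕ} (z : Fin n → X) {γ : Fin n → ℝ} (hγ : ∀ i, 0 ≤ γ i)
    (hsum : ∑ i, γ i ≠ 0) {h : X → Bool} (hh : Measurable h) :
    err (queryLaw D z γ) h = (∑ i, γ i * labelErr D (z i) (h (z i))) / ∑ i, γ i := by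
  have hpos : 0 ≤ ∑ i, γ i := Finset.sum_nonneg fun i _ => hγ i
  rw [err, Measure.real, queryLaw_apply D z hsum (measurableSet_error hh), ENNReal.toReal_sum
    fun _ _ => by finiteness, Finset.sum_div]
  refine Finset.sum_congr rfl fun i _ => ?_
  rw [ENNReal.toReal_mul, ENNReal.toReal_ofReal (div_nonneg (hγ i) hpos), div_mul_eq_mul_div]
  rfl

/-- The law of a query, as a Markov kernel; negative weights are replaced by zero. -/
noncomputable def queryKernel (n : ℕ) : Kernel ((Fin n → X) × (Fin n → ℝ)) (X × Bool) where
  toFun w := queryLaw D w.1 fun i => max (w.2 i) 0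
  measurable' := by
    refine Measure.measurable_of_measurable_coe _ fun B hB => ?_
    have hγ : ∀ i, Measurable fun w : (Fin n → X) × (Fin n → ℝ) => max (w.2 i) 0 :=
      fun i => by fun_prop
    have hsum : Measurable fun w : (Fin n → X) × (Fin n → ℝ) => ∑ i, max (w.2 i) 0 :=
      Finset.measurable_sum _ fun i _ => hγ i
    classical
    have : (fun w : (Fin n → X) × (Fin n → ℝ) => queryLaw D w.1 (fun i => max (w.2 i) 0) B)
        = fun w => if ∑ i, max (w.2 i) 0 = 0 then D B else
          ∑ i, ENNReal.ofReal (max (w.2 i) 0 / ∑ l, max (w.2 l) 0) *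
            D.condKernel (w.1 i) (Prod.mk (w.1 i) ⁻¹' B) := by
      ext w
      by_cases h : ∑ i, max (w.2 i) 0 = 0
      · rw [if_pos h, queryLaw, if_pos h]
      · rw [if_neg h, queryLaw_apply D w.1 h hB]
    rw [this]
    refine Measurable.ite (hsum (measurableSet_singleton 0)) measurable_const ?_
    refine Finset.measurable_sum _ fun i _ => ((hγ i).div hsum).ennreal_ofReal.mul ?_
    exact (Kernel.measurable_kernel_prodMk_left (κ := D.condKernel) hB).comp
      (f := fun w : (Fin n → X) × (Fin n → ℝ) => w.1 i) (by fun_prop)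

theorem queryKernel_apply {n : ℕ} (w : (Fin n → X) × (Fin n → ℝ)) :
    queryKernel D n w = queryLaw D w.1 fun i => max (w.2 i) 0 := rfl

instance (n : ℕ) : IsMarkovKernel (queryKernel D n) :=
  ⟨fun w => isProbabilityMeasure_queryLaw D w.1 fun _ => le_max_right _ _⟩

end Label

theorem Admissible.measurable {X : Type*} [MeasurableSpace X] {H : Set (X → Bool)}
    (hadm : Admissible H) : ∀ h ∈ H, Measurable h := by
  obtain ⟨Θ, _, _, f, hf, rfl⟩ := hadm
  rintro _ ⟨θ, rfl⟩
  exact hf.comp measurable_prodMk_left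

theorem adaptiveQuery_subset {X : Type*}
    (erm : Set (X → Bool) → (n : ℕ) → (Fin n → X × Bool) → X → Bool) (d : ℕ) (V : Set (X → Bool))
    (τ β : ℝ) (s : ℕ → ℕ → X × Bool) : adaptiveQuery erm d V τ β s ⊆ V := by
  rintro h ⟨j₀, -, -, -, hj⟩
  exact hj.1

theorem Input.epoch_subset {X : Type*} (I : Input X) (k : ℕ) (V : Set (X → Bool))
    (u : Fin (I.sizeU k) → X) (s : ℕ → ℕ → X × Bool) : I.epoch k V u s ⊆ V := by
  rw [Input.epoch]
  cases I.setting with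
  | realizable => exact fun h hh => hh.1
  | agnostic =>
    dsimp only
    split_ifs
    · exact subset_rfl
    · exact adaptiveQuery_subset _ _ _ _ _ _

theorem Input.candidates_subset {X : Type*} (I : Input X) (u : (k : ℕ) → Fin (I.sizeU k) → X)
    (s : ℕ → ℕ → ℕ → X × Bool) (k : ℕ) : I.candidates u s k ⊆ I.H := by
  induction k with
  | zero => exact subset_rfl
  | succ k ih => exact (I.epoch_subset _ _ _ _).trans ih

theorem Input.epsK_pos {X : Type*} (I : Input X) (hε : 0 < I.ε) (k : ℕ) : 0 < I.epsK k := by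
  rw [Input.epsK]; positivity

theorem Input.abstain_nonneg {X : Type*} (I : Input X) (hε : 0 < I.ε)
    (hP : I.P.HasGuaranteedError I.H) (k : ℕ) {V : Set (X → Bool)} (hV : V ⊆ I.H)
    (u : Fin (I.sizeU k) → X) (i : Fin (I.sizeU k)) : 0 ≤ I.abstain k V u i :=
  ((hP V hV _ u _ (by have := I.epsK_pos hε k; positivity)).1 i).2.2.1

/-! ## The samples of one epoch -/

/-- The candidate set at the beginning of epoch `k`. -/
noncomputable def current {X Ω : Type*} {I : Input X}
    (U : (k : ℕ) → Ω → Fin (I.sizeU k) → X) (S : ℕ → Ω → ℕ → ℕ → X × Bool)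
    (k : ℕ) (ω : Ω) : Set (X → Bool) :=
  I.candidates (fun l => U l ω) (fun l => S l ω) (k - 1)

/-- The abstention probabilities of epoch `k`. -/
noncomputable def weights {X Ω : Type*} {I : Input X}
    (U : (k : ℕ) → Ω → Fin (I.sizeU k) → X) (S : ℕ → Ω → ℕ → ℕ → X × Bool)
    (k : ℕ) (ω : Ω) : Fin (I.sizeU k) → ℝ :=
  I.abstain k (current U S k ω) (U k ω)

theorem weights_nonneg {X Ω : Type*} {I : Input X} {U : (k : ℕ) → Ω → Fin (I.sizeU k) → X}
    {S : ℕ → Ω → ℕ → ℕ → X × Bool} (hε : 0 < I.ε) (hP : I.P.HasGuaranteedError I.H) (k : ℕ) (ω : Ω)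
    (i : Fin (I.sizeU k)) : 0 ≤ weights U S k ω i :=
  I.abstain_nonneg hε hP k (I.candidates_subset _ _ _) _ i

section Epoch

variable {X Ω : Type*} [MeasurableSpace X] [MeasurableSpace Ω] {D : Measure (X × Bool)}
  [IsProbabilityMeasure D] {I : Input X} {μ : Measure Ω}
  {U : (k : ℕ) → Ω → Fin (I.sizeU k) → X} {S : ℕ → Ω → ℕ → ℕ → X × Bool}

theorem pastU_le (hrun : IsRun D I μ U S) {k : ℕ} (hk : k ∈ Finset.Icc 1 I.k₀) :
    pastU U S k ≤ (inferInstance : MeasurableSpace Ω) := by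
  rw [Finset.mem_Icc] at hk
  refine sup_le (iSup₂_le fun i hi => ?_)
    (hrun.measurable_U k (Finset.mem_Icc.2 hk)).comap_le
  rw [Finset.mem_Ico] at hi
  have hi' : i ∈ Finset.Icc 1 I.k₀ := Finset.mem_Icc.2 ⟨hi.1, by omega⟩
  exact sup_le (hrun.measurable_U i hi').comap_le (hrun.measurable_S i hi').comap_le

/-- The unlabelled sample and the abstention probabilities of an epoch have a version which is
measurable with respect to the past. -/
theorem exists_measurable_version (hrun : IsRun D I μ U S) {k : ℕ} (hk : k ∈ Finset.Icc 1 I.k₀) :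
    ∃ w : Ω → (Fin (I.sizeU k) → X) × (Fin (I.sizeU k) → ℝ), Measurable[pastU U S k] w ∧
      ∀ᵐ ω ∂μ, w ω = (U k ω, weights U S k ω) := by
  choose g hg hge using hrun.measurable_abstain k hk
  refine ⟨fun ω => (U k ω, fun i => g i ω), ?_, ?_⟩
  · refine Measurable.prodMk ?_ ?_
    · exact (comap_measurable (U k)).mono le_sup_right le_rfl
    · exact @measurable_pi_lambda _ _ _ (pastU U S k) _ _ fun i => (hg i).measurable
  · filter_upwards [ae_all_iff.2 hge] with ω hω
    exact Prod.ext rfl (funext fun i => (hω i).symm)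

/-- The relative deviation inequality for the labelled examples of an epoch. -/
theorem measure_relDev_labelled_le [IsProbabilityMeasure μ] (hε : 0 < I.ε)
    (hP : I.P.HasGuaranteedError I.H) (hadm : Admissible I.H) (hvc : HasVCDim I.H I.d)
    (hrun : IsRun D I μ U S) {k : ℕ} (hk : k ∈ Finset.Icc 1 I.k₀)
    {w : Ω → (Fin (I.sizeU k) → X) × (Fin (I.sizeU k) → ℝ)} (hw : Measurable[pastU U S k] w)
    (hwe : ∀ᵐ ω ∂μ, w ω = (U k ω, weights U S k ω)) (j : ℕ) {n : ℕ} (hn : 0 < n) {δ : ℝ}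
    (hδ : 0 < δ) (hδ1 : δ ≤ 1) {C : Set ((Fin (I.sizeU k) → X) × (Fin (I.sizeU k) → ℝ))}
    (hC : MeasurableSet C) :
    μ {ω | (U k ω, weights U S k ω) ∈ C ∧ (fun i : Fin n => S k ω j i) ∈
      relDev I.H Prod.fst zeroOne (sigma I.d n δ) n (queryLaw D (U k ω) (weights U S k ω))}
      ≤ ENNReal.ofReal (2 * δ) * μ (w ⁻¹' C) := by
  have hq : ∀ᵐ ω ∂μ, queryKernel D (I.sizeU k) (w ω)
      = queryLaw D (U k ω) (weights U S k ω) := by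
    filter_upwards [hwe] with ω hω
    rw [queryKernel_apply, hω]
    congr 1
    ext i
    exact max_eq_left (weights_nonneg hε hP k ω i)
  have hw' : Measurable w := hw.mono (pastU_le hrun hk) le_rfl
  have hs : Measurable fun ω => fun i : Fin n => S k ω j i := by
    refine measurable_pi_lambda _ fun i => ?_
    exact (measurable_pi_apply (i : ℕ)).comp
      ((measurable_pi_apply j).comp (hrun.measurable_S k hk))
  refine le_trans (measure_mono_ae ?_) (measure_inter_relDev_le (queryKernel D (I.sizeU k)) hn hw'
    hs (fun C hC B hB => ?_) hadm hvc measurable_fst measurable_zeroOne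
    (fun p b => by rw [zeroOne]; split_ifs <;> norm_num)
    (fun p b => by rw [zeroOne]; split_ifs <;> norm_num) hδ hδ1 hC)
  · filter_upwards [hwe, hq] with ω h1 h2
    rintro ⟨h3, h4⟩
    exact ⟨h1 ▸ h3, h2 ▸ h4⟩
  · let e : Fin n ↪ ℕ × ℕ := ⟨fun i => (j, i), fun a b hab => Fin.ext (Prod.ext_iff.1 hab).2⟩
    let B' : ℕ × ℕ → Set (X × Bool) := fun t => if h : t.2 < n then B ⟨t.2, h⟩ else Set.univ
    have hB'm : ∀ t, MeasurableSet (B' t) := fun t => by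
      simp only [B']
      split_ifs
      · exact hB _
      · exact MeasurableSet.univ
    have hB'e : ∀ i, B' (e i) = B i := fun i => dif_pos i.2
    have h := hrun.law_S k hk (w ⁻¹' C) (hw hC) (Finset.univ.map e) B' hB'm
    simp only [Finset.prod_map, Finset.mem_map, Finset.mem_univ, true_and, forall_exists_index,
      forall_apply_eq_imp_iff, hB'e] at h
    refine Eq.trans ?_ (h.trans ?_)
    · rfl
    · refine lintegral_congr_ae (ae_restrict_of_ae ?_)
      filter_upwards [hq] with ω hω
      rw [hω]
      rfl

/-- The deviation inequality for the unlabelled sample of an epoch. -/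
theorem measure_relDev_unlabelled_le (hadm : Admissible I.H)
    (hvc : HasVCDim I.H I.d) (hrun : IsRun D I μ U S) {k : ℕ} (hk : k ∈ Finset.Icc 1 I.k₀)
    (hn : 0 < I.sizeU k) {δ : ℝ} (hδ : 0 < δ) (hδ1 : δ ≤ 1) :
    μ {ω | U k ω ∈ relDev I.H id (labelErr D) (sigma I.d (I.sizeU k) δ) (I.sizeU k) D.fst}
      ≤ ENNReal.ofReal (2 * δ) := by
  refine (Measure.le_map_apply (hrun.measurable_U k hk).aemeasurable _).trans ?_
  rw [hrun.law_U k hk]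
  exact measure_relDev_le hadm hvc D.fst measurable_id (measurable_labelErr D)
    (labelErr_nonneg D) (labelErr_le_one D) hn hδ hδ1

/-- A classifier without error makes no error on the examples of an epoch. -/
theorem ae_forall_eq_of_err_eq_zero (hrun : IsRun D I μ U S) {k : ℕ} (hk : k ∈ Finset.Icc 1 I.k₀)
    {h : X → Bool} (hh : Measurable h) (herr : err D h = 0) :
    ∀ᵐ ω ∂μ, ∀ i, h (S k ω 0 i).1 = (S k ω 0 i).2 := by
  have hlm : Measurable fun x => labelErr D x (h x) :=
    (measurable_loss (Θ := Unit) (f := fun _ => h) (hh.comp measurable_snd) measurable_id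
      (measurable_labelErr D)).comp (measurable_const (a := ()) |>.prodMk measurable_id)
  have hint : Integrable (fun x => labelErr D x (h x)) D.fst :=
    Integrable.of_bound hlm.aestronglyMeasurable 1 (Filter.Eventually.of_forall fun x => by
      rw [Real.norm_eq_abs, abs_of_nonneg (labelErr_nonneg D _ _)]
      exact labelErr_le_one D _ _)
  have h0 : ∀ᵐ x ∂D.fst, labelErr D x (h x) = 0 := by
    rw [← integral_labelErr D hh, integral_eq_zero_iff_of_nonneg
      (fun x => labelErr_nonneg D _ _) hint] at herr
    exact herr
  have h1 : ∀ᵐ ω ∂μ, ∀ i, labelErr D (U k ω i) (h (U k ω i)) = 0 := by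
    have h2 : ∀ᵐ u ∂(Measure.pi fun _ : Fin (I.sizeU k) => D.fst),
        ∀ i, labelErr D (u i) (h (u i)) = 0 := by
      refine ae_all_iff.2 fun i => ?_
      exact (measurePreserving_eval (fun _ : Fin (I.sizeU k) => D.fst) i).quasiMeasurePreserving.ae
        h0
    rw [← hrun.law_U k hk] at h2
    exact ae_of_ae_map (hrun.measurable_U k hk).aemeasurable h2
  have hB := measurableSet_error hh
  have hD0 : D {p : X × Bool | h p.1 ≠ p.2} = 0 := by
    rw [err, measureReal_eq_zero_iff] at herr
    exact herr
  refine ae_all_iff.2 fun i => ?_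
  have hlaw := hrun.law_S k hk Set.univ MeasurableSet.univ {(0, i)}
    (fun _ => {p : X × Bool | h p.1 ≠ p.2}) fun _ => hB
  simp only [Set.univ_inter, Finset.mem_singleton, forall_eq, Finset.prod_singleton,
    Measure.restrict_univ] at hlaw
  refine Eq.trans hlaw ((lintegral_congr_ae ?_).trans lintegral_zero)
  filter_upwards [h1] with ω hω
  -- With total weight zero the query law is `D` by convention, and `D` also gives the error set
  -- mass zero.
  by_cases hs : ∑ l, I.abstain k
      (I.candidates (fun l => U l ω) (fun l => S l ω) (k - 1)) (U k ω) l = 0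
  · rw [queryLaw, if_pos hs, hD0]
  · rw [queryLaw_apply D _ hs hB]
    refine Finset.sum_eq_zero fun l _ => ?_
    have := hω l
    rw [labelErr, measureReal_eq_zero_iff] at this
    have h4 : D.condKernel (U k ω l) (Prod.mk (U k ω l) ⁻¹' {p : X × Bool | h p.1 ≠ p.2}) = 0 :=
      this
    rw [h4, mul_zero]

end Epoch

/-! ## Estimates for `sigma` -/

theorem two_mul_log_max_nonneg (d n : ℕ) :
    0 ≤ 2 * d * Real.log (2 * Real.exp 1 * (max n d : ℕ) / d) := by
  rcases Nat.eq_zero_or_pos d with rfl | hd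
  · simp
  · have hd' : (0 : ℝ) < d := by exact_mod_cast hd
    have : 1 ≤ 2 * Real.exp 1 * (max n d : ℕ) / d := by
      rw [le_div_iff₀ hd', one_mul]
      have h1 : (d : ℝ) ≤ (max n d : ℕ) := by exact_mod_cast le_max_right n d
      nlinarith [Real.add_one_le_exp (1 : ℝ)]
    have := Real.log_nonneg this
    positivity

theorem sigma_nonneg (d n : ℕ) {δ : ℝ} (hδ : 0 < δ) (hδ1 : δ ≤ 1) : 0 ≤ sigma d n δ := by
  have h1 := two_mul_log_max_nonneg d n
  have h2 : 0 ≤ Real.log (24 / δ) :=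
    Real.log_nonneg (by rw [le_div_iff₀ hδ]; linarith)
  rw [sigma]
  positivity

/-- This is `log t ≤ t - 1` at `t = 2 n / (d b)`. The parameter `b` trades the implicit `log n` for
a term linear in `n`, which `sigma` divides by `n`, plus `log b`; sample sizes without `log n` then
suffice. -/
theorem two_mul_log_max_le {d n : ℕ} (hdn : d ≤ n) {b : ℝ} (hb : 0 < b) :
    2 * d * Real.log (2 * Real.exp 1 * (max n d : ℕ) / d) ≤ 4 * n / b + 2 * d * Real.log b := by
  rcases Nat.eq_zero_or_pos d with rfl | hd
  · simp; positivity
  · have hd' : (0 : ℝ) < d := by exact_mod_cast hd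
    have hn' : (0 : ℝ) < n := by exact_mod_cast hd.trans_le hdn
    rw [max_eq_left hdn]
    have he := Real.exp_pos 1
    have h := Real.log_le_sub_one_of_pos (show 0 < 2 * (n : ℝ) / (d * b) by positivity)
    have e : Real.log (2 * Real.exp 1 * n / d)
        = Real.log (2 * (n : ℝ) / (d * b)) + 1 + Real.log b := by
      rw [show 2 * Real.exp 1 * (n : ℝ) / d = 2 * (n : ℝ) / (d * b) * Real.exp 1 * b by field_simp,
        Real.log_mul (by positivity) hb.ne', Real.log_mul (by positivity) he.ne', Real.log_exp]
    have h2 : 2 * d * (2 * (n : ℝ) / (d * b)) = 4 * n / b := by field_simp; ring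
    rw [e, ← h2]
    nlinarith

/-- The sample size of the realizable version makes `sigma` small. -/
theorem sigma_le_of_numQueries {d m : ℕ} {x δ : ℝ} (hx : 96 ≤ x) (hδ : 0 < δ) (hδ1 : δ ≤ 1)
    (hm : x * (d * Real.log x + Real.log (48 / δ)) ≤ m) : sigma d m (δ / 2) ≤ 96 / x := by
  have hx0 : 0 < x := by linarith
  have hlx : 1 ≤ Real.log x := by
    rw [Real.le_log_iff_exp_le hx0]
    linarith [Real.exp_one_lt_d9]
  have hld : 0 < Real.log (48 / δ) := Real.log_pos (by rw [lt_div_iff₀ hδ]; linarith)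
  set K := d * Real.log x + Real.log (48 / δ) with hK
  have hd0 : (0 : ℝ) ≤ d := Nat.cast_nonneg d
  have hK0 : 0 < K := by positivity
  have hm0 : (0 : ℝ) < m := lt_of_lt_of_le (by positivity) hm
  have hdK : (d : ℝ) ≤ K := by nlinarith
  have hdm : d ≤ m := by
    have : (d : ℝ) ≤ m := by nlinarith
    exact_mod_cast this
  have h := two_mul_log_max_le hdm hx0
  rw [sigma, show (24 : ℝ) / (δ / 2) = 48 / δ by field_simp; norm_num]
  have h1 : (8 : ℝ) / m * (2 * d * Real.log (2 * Real.exp 1 * (max m d : ℕ) / d)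
      + Real.log (48 / δ)) ≤ 8 / m * (4 * m / x + 2 * K) := by
    refine mul_le_mul_of_nonneg_left ?_ (by positivity)
    rw [hK]
    linarith
  refine h1.trans ?_
  have h2 : (8 : ℝ) / m * (4 * m / x + 2 * K) = 32 / x + 16 * K / m := by field_simp; ring
  have h3 : 16 * K / m ≤ 16 / x := by
    rw [div_le_div_iff₀ hm0 hx0]
    nlinarith
  rw [h2]
  calc 32 / x + 16 * K / m ≤ 32 / x + 16 / x := by gcongr
    _ ≤ 96 / x := by rw [← add_div]; gcongr; norm_num

/-- The size of the unlabelled samples makes `sigma` small. -/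
theorem sigma_add_sqrt_le_of_sizeU {d n : ℕ} {A δ : ℝ} (hA : 128 ≤ A) (hδ : 0 < δ) (hδ1 : δ ≤ 1)
    (hn : 192 * A ^ 2 * (d * Real.log A + Real.log (288 / δ)) ≤ n) :
    sigma d n (δ / 20) + √(sigma d n (δ / 20)) ≤ 8 / A := by
  have hA0 : 0 < A := by linarith
  have hlA : 1 ≤ Real.log A := by
    rw [Real.le_log_iff_exp_le hA0]
    linarith [Real.exp_one_lt_d9]
  have hld : 0 < Real.log (288 / δ) := Real.log_pos (by rw [lt_div_iff₀ hδ]; linarith)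
  set K := d * Real.log A + Real.log (288 / δ) with hK
  have hd0 : (0 : ℝ) ≤ d := Nat.cast_nonneg d
  have hK0 : 0 < K := by positivity
  have hn0 : (0 : ℝ) < n := lt_of_lt_of_le (by positivity) hn
  have hdK : (d : ℝ) ≤ K := by nlinarith
  have hdn : d ≤ n := by
    have hA2 : 1 ≤ 192 * A ^ 2 := by nlinarith
    have : (d : ℝ) ≤ n := hdK.trans ((le_mul_of_one_le_left hK0.le hA2).trans hn)
    exact_mod_cast this
  have hl480 : Real.log (480 / δ) ≤ 2 * Real.log (288 / δ) := by
    have : Real.log ((288 / δ) ^ 2) = 2 * Real.log (288 / δ) := by rw [Real.log_pow]; norm_num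
    rw [← this]
    refine Real.log_le_log (by positivity) ?_
    rw [div_pow, div_le_div_iff₀ hδ (by positivity)]
    nlinarith
  -- The square root of `sigma` must be of order `1 / A`, so here `b = A ^ 2`, as opposed to `b = x`
  -- in the realizable estimate, where `sigma` itself is compared with `1 / x`.
  have h := two_mul_log_max_le hdn (show 0 < A ^ 2 by positivity)
  rw [Real.log_pow] at h
  push_cast at h
  have hσ : sigma d n (δ / 20) ≤ 33 / A ^ 2 := by
    rw [sigma, show (24 : ℝ) / (δ / 20) = 480 / δ by field_simp; norm_num]
    have h1 : (8 : ℝ) / n * (2 * d * Real.log (2 * Real.exp 1 * (max n d : ℕ) / d)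
        + Real.log (480 / δ)) ≤ 8 / n * (4 * n / A ^ 2 + 4 * K) := by
      refine mul_le_mul_of_nonneg_left ?_ (by positivity)
      rw [hK]
      push_cast
      linarith
    refine h1.trans ?_
    have h2 : (8 : ℝ) / n * (4 * n / A ^ 2 + 4 * K) = 32 / A ^ 2 + 32 * K / n := by
      field_simp; ring
    have h3 : 32 * K / n ≤ 1 / A ^ 2 := by
      rw [div_le_div_iff₀ hn0 (by positivity)]
      nlinarith [mul_pos (mul_pos hA0 hA0) hK0]
    rw [h2]
    calc 32 / A ^ 2 + 32 * K / n ≤ 32 / A ^ 2 + 1 / A ^ 2 := by gcongr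
      _ = 33 / A ^ 2 := by ring
  have hσ' : √(sigma d n (δ / 20)) ≤ 6 / A := by
    rw [Real.sqrt_le_left (by positivity), div_pow]
    exact hσ.trans (by gcongr; norm_num)
  have h33 : 33 / A ^ 2 ≤ 2 / A := by
    rw [div_le_div_iff₀ (by positivity) hA0]
    nlinarith
  calc sigma d n (δ / 20) + √(sigma d n (δ / 20)) ≤ 2 / A + 6 / A := by linarith
    _ = 8 / A := by ring

/-- In the adaptive procedure `sigma` tends to zero. -/
theorem tendsto_sigma (d : ℕ) {β : ℝ} (hβ : 0 < β) (hβ1 : β ≤ 1) :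
    Tendsto (fun j : ℕ => sigma d (2 ^ j) (β / (j * (j + 1)))) atTop (𝓝 0) := by
  have h1 : Tendsto (fun j : ℕ => (j : ℝ) * (1 / 2) ^ j) atTop (𝓝 0) :=
    tendsto_self_mul_const_pow_of_lt_one (by norm_num) (by norm_num)
  have h2 : Tendsto (fun j : ℕ => ((1 : ℝ) / 2) ^ j) atTop (𝓝 0) :=
    tendsto_pow_atTop_nhds_zero_of_lt_one (by norm_num) (by norm_num)
  have h3 : Tendsto (fun j : ℕ => 8 * ((2 * d * Real.log (2 * Real.exp 1) + Real.log (24 / β))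
      * (1 / 2) ^ j + (2 * d * Real.log 2 + 2) * ((j : ℝ) * (1 / 2) ^ j))) atTop (𝓝 0) := by
    have := ((h2.const_mul (2 * d * Real.log (2 * Real.exp 1) + Real.log (24 / β))).add
      (h1.const_mul (2 * d * Real.log 2 + 2))).const_mul 8
    simpa using this
  refine squeeze_zero' ?_ ?_ h3
  · filter_upwards [eventually_ge_atTop 1] with j hj
    have hj' : (1 : ℝ) ≤ j := by exact_mod_cast hj
    refine sigma_nonneg d _ (by positivity) ?_
    rw [div_le_one (by positivity)]
    nlinarith
  · filter_upwards [eventually_ge_atTop 1] with j hj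
    have hj' : (1 : ℝ) ≤ j := by exact_mod_cast hj
    have e1 : 2 * d * Real.log (2 * Real.exp 1 * (max (2 ^ j) d : ℕ) / d)
        ≤ 2 * d * (Real.log (2 * Real.exp 1) + j * Real.log 2) := by
      rcases Nat.eq_zero_or_pos d with rfl | hd
      · simp
      have hd' : (1 : ℝ) ≤ d := by exact_mod_cast hd
      have hmax : ((max (2 ^ j) d : ℕ) : ℝ) ≤ 2 ^ j * d := by
        have : max (2 ^ j) d ≤ 2 ^ j * d :=
          max_le (Nat.le_mul_of_pos_right _ hd) (Nat.le_mul_of_pos_left _ (by positivity))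
        exact_mod_cast this
      have hmax0 : (0 : ℝ) < (max (2 ^ j) d : ℕ) := by
        exact_mod_cast lt_max_of_lt_right hd
      gcongr
      rw [← Real.log_pow, ← Real.log_mul (by positivity) (by positivity)]
      refine Real.log_le_log (by positivity) ?_
      rw [div_le_iff₀ (by linarith)]
      nlinarith [Real.exp_pos 1]
    have e2 : Real.log (24 / (β / (j * (j + 1)))) ≤ Real.log (24 / β) + 2 * j := by
      rw [show 24 / (β / ((j : ℝ) * (j + 1))) = 24 / β * (j * (j + 1)) by field_simp,
        Real.log_mul (by positivity) (by positivity), Real.log_mul (by positivity) (by positivity)]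
      have a1 := Real.log_le_sub_one_of_pos (show (0 : ℝ) < j by linarith)
      have a2 := Real.log_le_sub_one_of_pos (show (0 : ℝ) < j + 1 by linarith)
      linarith
    rw [sigma]
    have e3 : (8 : ℝ) / (2 ^ j : ℕ) = 8 * (1 / 2) ^ j := by
      push_cast
      rw [one_div, inv_pow]
      rfl
    rw [e3]
    calc 8 * (1 / 2 : ℝ) ^ j * (2 * d * Real.log (2 * Real.exp 1 * (max (2 ^ j) d : ℕ) / d)
          + Real.log (24 / (β / (j * (j + 1)))))
        ≤ 8 * (1 / 2 : ℝ) ^ j * (2 * d * (Real.log (2 * Real.exp 1) + j * Real.log 2)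
          + (Real.log (24 / β) + 2 * j)) := by gcongr
      _ = _ := by ring

/-! ## The adaptive procedure -/

theorem empDis_nonneg {X : Type*} {n : ℕ} (s : Fin n → X × Bool) (h g : X → Bool) :
    0 ≤ empDis s h g := by rw [empDis]; positivity

theorem empDis_le_one {X : Type*} {n : ℕ} (s : Fin n → X × Bool) (h g : X → Bool) :
    empDis s h g ≤ 1 := by
  rw [empDis]
  refine div_le_one_of_le₀ ?_ (Nat.cast_nonneg n)
  exact_mod_cast (Finset.card_le_univ _).trans_eq (Fintype.card_fin n)

theorem empDis_comm {X : Type*} {n : ℕ} (s : Fin n → X × Bool) (h g : X → Bool) :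
    empDis s h g = empDis s g h := by
  simp only [empDis, ne_comm]

theorem empDis_triangle {X : Type*} {n : ℕ} (s : Fin n → X × Bool) (h f g : X → Bool) :
    empDis s h g ≤ empDis s h f + empDis s f g := by
  rw [empDis, empDis, empDis, ← add_div]
  gcongr
  rw [← Nat.cast_add]
  refine Nat.cast_le.2 ((Finset.card_le_card fun i hi => ?_).trans (Finset.card_union_le _ _))
  simp only [Finset.mem_filter, Finset.mem_univ, true_and, Finset.mem_union] at hi ⊢
  by_contra! hcon
  exact hi (hcon.1.trans hcon.2)

/-- If the samples of all rounds are representative of `Q`, then the adaptive procedure keeps each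
classifier `hstar` which is nearly optimal for `Q`, and it keeps nearly optimal classifiers only. -/
theorem adaptiveQuery_spec {X : Type*} [MeasurableSpace X]
    {erm : Set (X → Bool) → (n : ℕ) → (Fin n → X × Bool) → X → Bool} (herm : IsERM erm) (d : ℕ)
    {V : Set (X → Bool)} {τ β : ℝ} (hτ : 0 < τ) (hβ : 0 < β) (hβ1 : β ≤ 1)
    (s : ℕ → ℕ → X × Bool) (Q : Measure (X × Bool)) {hstar : X → Bool} (hV : hstar ∈ V)
    (hopt : ∀ h ∈ V, err Q hstar - err Q h ≤ τ / 2)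
    (hgood : ∀ j : ℕ, 1 ≤ j → ∀ h ∈ V, ∀ g ∈ V,
      (empErr (fun i : Fin (2 ^ j) => s j i) h - empErr (fun i : Fin (2 ^ j) => s j i) g)
        - (err Q h - err Q g) ≤ sigma d (2 ^ j) (β / (j * (j + 1)))
          + √(sigma d (2 ^ j) (β / (j * (j + 1))) * empDis (fun i : Fin (2 ^ j) => s j i) h g)) :
    hstar ∈ adaptiveQuery erm d V τ β s ∧
      ∀ h ∈ adaptiveQuery erm d V τ β s, err Q h - err Q hstar ≤ τ := by
  set σ : ℕ → ℝ := fun j => sigma d (2 ^ j) (β / (j * (j + 1))) with hσ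
  set T : (j : ℕ) → Fin (2 ^ j) → X × Bool := fun j i => s j i with hT
  set hhat : ℕ → X → Bool := fun j => erm V (2 ^ j) (T j) with hhatdef
  have hhV : ∀ j, hhat j ∈ V := fun j => (herm V _ (T j) ⟨hstar, hV⟩).1
  have hmem : ∀ j, 1 ≤ j → hstar ∈ roundSet d V τ β j (T j) (hhat j) := fun j hj => by
    refine ⟨hV, ?_⟩
    have h1 := hgood j hj hstar hV (hhat j) (hhV j)
    have h2 := hopt (hhat j) (hhV j)
    linarith
  -- Halting is automatic: disagreements are at most `1`, so the criterion holds once `σ j + √(σ j)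
  -- ≤ τ / 6`.
  have hex : ∃ j, 1 ≤ j ∧ Stops d V τ β j (T j) (hhat j) := by
    have h0 := tendsto_sigma d hβ hβ1
    have hlim : Tendsto (fun j => σ j + √(σ j)) atTop (𝓝 0) := by
      simpa using h0.add h0.sqrt
    obtain ⟨j, hj, hj1⟩ := ((hlim.eventually_le_const (show (0 : ℝ) < τ / 6 by positivity)).and
      (eventually_ge_atTop 1)).exists
    refine ⟨j, hj1, fun h _ => le_trans ?_ hj⟩
    have hσ0 : 0 ≤ σ j := sigma_nonneg d _ (by
        have : (1 : ℝ) ≤ j := by exact_mod_cast hj1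
        positivity) (by
        have : (1 : ℝ) ≤ j := by exact_mod_cast hj1
        rw [div_le_one (by positivity)]
        nlinarith)
    gcongr
    exact mul_le_of_le_one_right hσ0 (empDis_le_one _ _ _)
  refine ⟨?_, ?_⟩
  · classical
    exact ⟨Nat.find hex, (Nat.find_spec hex).1, (Nat.find_spec hex).2,
      fun j h1 hj hs => Nat.find_min hex hj ⟨h1, hs⟩, hmem _ (Nat.find_spec hex).1⟩
  · rintro h ⟨j, hj, hterm, -, hh⟩
    have hj' : (1 : ℝ) ≤ j := by exact_mod_cast hj
    have hσ0 : 0 ≤ σ j := sigma_nonneg d _ (by positivity) (by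
      rw [div_le_one (by positivity)]
      nlinarith)
    have a1 := hterm h hh
    have a2 := hterm hstar (hmem j hj)
    have a3 := hh.2
    have a4 := (herm V _ (T j) ⟨hstar, hV⟩).2 hstar hV
    have a5 := hgood j hj hstar hV h hh.1
    have a6 : √(σ j * empDis (T j) hstar h)
        ≤ √(σ j * empDis (T j) h (hhat j)) + √(σ j * empDis (T j) hstar (hhat j)) := by
      have := empDis_triangle (T j) hstar (hhat j) h
      rw [empDis_comm (T j) (hhat j) h] at this
      refine (Real.sqrt_le_sqrt (mul_le_mul_of_nonneg_left this hσ0)).trans ?_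
      rw [mul_add, add_comm]
      have h1 := mul_nonneg hσ0 (empDis_nonneg (T j) h (hhat j))
      have h2 := mul_nonneg hσ0 (empDis_nonneg (T j) hstar (hhat j))
      rw [Real.sqrt_le_left (by positivity), add_sq, Real.sq_sqrt h1, Real.sq_sqrt h2]
      linarith [mul_nonneg (Real.sqrt_nonneg (σ j * empDis (T j) h (hhat j)))
        (Real.sqrt_nonneg (σ j * empDis (T j) hstar (hhat j)))]
    change empErr (T j) h ≤ empErr (T j) (hhat j) + τ / 2 + σ j + √(σ j * empDis (T j) h (hhat j))
      at a3
    change σ j + √(σ j * empDis (T j) h (hhat j)) ≤ τ / 6 at a1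
    change σ j + √(σ j * empDis (T j) hstar (hhat j)) ≤ τ / 6 at a2
    change empErr (T j) (hhat j) ≤ empErr (T j) hstar at a4
    change (empErr (T j) hstar - empErr (T j) h) - (err Q hstar - err Q h)
      ≤ σ j + √(σ j * empDis (T j) hstar h) at a5
    -- The budget: membership of `h` in the round set gives `τ / 2` plus a quantity at most `τ / 6`
    -- by the stopping rule. The deviation between `hstar` and `h`, routed through the empirical
    -- minimizer by `a6`, adds at most `τ / 6` for each of the two.
    linarith

/-! ## One epoch, on the good event -/

section Epoch

variable {X : Type*} [MeasurableSpace X] (D : Measure (X × Bool)) [IsProbabilityMeasure D]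

/-- The conditional expected error of `h` on the unlabelled sample `u`. -/
noncomputable def sampleErr {n : ℕ} (u : Fin n → X) (h : X → Bool) : ℝ :=
  (∑ i, labelErr D (u i) (h (u i))) / n

/-- By the error guarantee of the predictor, the classifiers of `V` can differ in error on the
unlabelled sample essentially only where the predictor abstains. -/
theorem abs_sampleErr_sub_le {I : Input X} (hε : 0 < I.ε) (hP : I.P.HasGuaranteedError I.H) (k : ℕ)
    (hn : 0 < I.sizeU k) {V : Set (X → Bool)} (hV : V ⊆ I.H) (u : Fin (I.sizeU k) → X)
    {h g : X → Bool} (hh : h ∈ V) (hg : g ∈ V) (hhm : Measurable h) (hgm : Measurable g) :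
    |sampleErr D u h - sampleErr D u g - I.phi k V u *
      (err (queryLaw D u (I.abstain k V u)) h - err (queryLaw D u (I.abstain k V u)) g)|
      ≤ I.epsK k / 32 := by
  have hn' : (0 : ℝ) < I.sizeU k := by exact_mod_cast hn
  have hεk := I.epsK_pos hε k
  obtain ⟨hprob, herr⟩ := hP V hV _ u (I.epsK k / 64) (by positivity)
  set γ := I.abstain k V u with hγdef
  have hγ0 : ∀ i, 0 ≤ γ i := I.abstain_nonneg hε hP k hV u
  set ξ := I.P.xi V (I.sizeU k) u (I.epsK k / 64)
  set ζ := I.P.zeta V (I.sizeU k) u (I.epsK k / 64)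
  have hprob' : ∀ i, 0 ≤ ξ i ∧ 0 ≤ ζ i ∧ 0 ≤ γ i ∧ ξ i + ζ i + γ i = 1 := hprob
  let c : (X → Bool) → Fin (I.sizeU k) → ℝ := fun h i => labelErr D (u i) (h (u i))
  have hphi : I.phi k V u * (err (queryLaw D u γ) h - err (queryLaw D u γ) g)
      = (∑ i, γ i * (c h i - c g i)) / I.sizeU k := by
    rw [Input.phi]
    change (∑ i, γ i) / _ * _ = _
    by_cases h0 : ∑ i, γ i = 0
    · have hz : ∀ i, γ i = 0 := fun i =>
        (Finset.sum_eq_zero_iff_of_nonneg fun i _ => hγ0 i).1 h0 i (Finset.mem_univ i)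
      simp [hz]
    · rw [err_queryLaw D u hγ0 h0 hhm, err_queryLaw D u hγ0 h0 hgm, ← sub_div,
        ← Finset.sum_sub_distrib]
      simp only [c, mul_sub]
      field_simp
  have hsplit : sampleErr D u h - sampleErr D u g
      - I.phi k V u * (err (queryLaw D u γ) h - err (queryLaw D u γ) g)
      = (∑ i, (1 - γ i) * (c h i - c g i)) / I.sizeU k := by
    rw [hphi, sampleErr, sampleErr, ← sub_div, ← sub_div, ← Finset.sum_sub_distrib,
      ← Finset.sum_sub_distrib]
    congr 1
    exact Finset.sum_congr rfl fun i _ => by simp only [c]; ring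
  rw [hsplit, abs_div, abs_of_pos hn', div_le_iff₀ hn']
  -- Where `h` and `g` disagree, one of the two charges is `ζ i` and the other is `ξ i`, and
  -- together they make up `1 - γ i`. Where they agree, the left side vanishes.
  have hpt : ∀ i, |(1 - γ i) * (c h i - c g i)| ≤ (if h (u i) = true then ζ i else ξ i)
      + (if g (u i) = true then ζ i else ξ i) := by
    intro i
    obtain ⟨h1, h2, h3, h4⟩ := hprob' i
    by_cases heq : h (u i) = g (u i)
    · have : c h i - c g i = 0 := by simp only [c, heq, sub_self]
      rw [this, mul_zero, abs_zero]
      split_ifs <;> linarith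
    · have hc : |c h i - c g i| ≤ 1 := abs_le.2
        ⟨by linarith [labelErr_nonneg D (u i) (h (u i)), labelErr_le_one D (u i) (g (u i))],
          by linarith [labelErr_nonneg D (u i) (g (u i)), labelErr_le_one D (u i) (h (u i))]⟩
      have hγ1 : 1 - γ i = ξ i + ζ i := by linarith
      rw [abs_mul, hγ1, abs_of_nonneg (by linarith)]
      refine (mul_le_of_le_one_right (by linarith) hc).trans ?_
      cases hhu : h (u i) <;> cases hgu : g (u i) <;> simp_all [add_comm]
  calc |∑ i, (1 - γ i) * (c h i - c g i)| ≤ ∑ i, |(1 - γ i) * (c h i - c g i)| :=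
        Finset.abs_sum_le_sum_abs _ _
    _ ≤ ∑ i, ((if h (u i) = true then ζ i else ξ i) + (if g (u i) = true then ζ i else ξ i)) :=
        Finset.sum_le_sum fun i _ => hpt i
    _ ≤ I.epsK k / 64 * I.sizeU k + I.epsK k / 64 * I.sizeU k := by
        rw [Finset.sum_add_distrib]
        exact add_le_add (herr h hh) (herr g hg)
    _ = I.epsK k / 32 * I.sizeU k := by ring

/-- The good event for the unlabelled sample `u` of epoch `k`. -/
def GoodU (I : Input X) (k : ℕ) (u : Fin (I.sizeU k) → X) : Prop :=
  u ∉ relDev I.H id (labelErr D) (sigma I.d (I.sizeU k) (I.deltaK k / 20)) (I.sizeU k) D.fst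

/-- The good event for the labelled examples `s` of epoch `k`. -/
def GoodS (I : Input X) (hstar : X → Bool) (k : ℕ) (V : Set (X → Bool))
    (u : Fin (I.sizeU k) → X) (s : ℕ → ℕ → X × Bool) : Prop :=
  match I.setting with
  | .realizable => (∀ i, hstar (s 0 i).1 = (s 0 i).2) ∧
      ∀ m, 0 < m → I.numQueries k (I.phi k V u) = m →
        (fun i : Fin m => s 0 i) ∉ relDev I.H Prod.fst zeroOne
          (sigma I.d m (I.deltaK k / 2)) m (queryLaw D u (I.abstain k V u))
  | .agnostic => ∀ j : ℕ, 1 ≤ j → (fun i : Fin (2 ^ j) => s j i) ∉ relDev I.H Prod.fst zeroOne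
      (sigma I.d (2 ^ j) (I.deltaK k / 2 / (j * (j + 1)))) (2 ^ j)
      (queryLaw D u (I.abstain k V u))

/-- The loss distance is bounded crudely by `1`, and `n_k` is large enough for `σ + √σ ≤ ε_k / 32`.
Since `relDev` bounds the empirical difference minus the true one, it is applied with `h` and `g`
exchanged. -/
theorem err_sub_le_of_goodU {I : Input X} (hε : 0 < I.ε) (hadm : Admissible I.H) {k : ℕ}
    (hεk : I.epsK k ≤ 2) (hδ0 : 0 < I.deltaK k) (hδ1 : I.deltaK k ≤ 1)
    {u : Fin (I.sizeU k) → X} (hu : GoodU D I k u) {h g : X → Bool} (hh : h ∈ I.H)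
    (hg : g ∈ I.H) :
    (err D h - err D g) - (sampleErr D u h - sampleErr D u g) ≤ I.epsK k / 32 := by
  have hεk0 := I.epsK_pos hε k
  by_contra hcon
  refine hu ⟨g, hg, h, hh, ?_⟩
  have hρ1 : (∑ i, |labelErr D (u i) (g (u i)) - labelErr D (u i) (h (u i))|) / I.sizeU k ≤ 1 := by
    refine div_le_one_of_le₀ ?_ (Nat.cast_nonneg _)
    refine (Finset.sum_le_card_nsmul Finset.univ _ 1 fun i _ => abs_le.2 ⟨?_, ?_⟩).trans ?_
    · linarith [labelErr_nonneg D (u i) (g (u i)), labelErr_le_one D (u i) (h (u i))]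
    · linarith [labelErr_nonneg D (u i) (h (u i)), labelErr_le_one D (u i) (g (u i))]
    · simp
  have hA : 128 ≤ 256 / I.epsK k := by rw [le_div_iff₀ hεk0]; linarith
  have hσ := sigma_add_sqrt_le_of_sizeU (d := I.d) (n := I.sizeU k) hA hδ0 hδ1 (Nat.le_ceil _)
  have hσ0 : 0 ≤ sigma I.d (I.sizeU k) (I.deltaK k / 20) :=
    sigma_nonneg _ _ (by positivity) (by linarith)
  have hsq : √(sigma I.d (I.sizeU k) (I.deltaK k / 20) *
      ((∑ i, |labelErr D (u i) (g (u i)) - labelErr D (u i) (h (u i))|) / I.sizeU k))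
      ≤ √(sigma I.d (I.sizeU k) (I.deltaK k / 20)) :=
    Real.sqrt_le_sqrt (mul_le_of_le_one_right hσ0 hρ1)
  have h8 : 8 / (256 / I.epsK k) = I.epsK k / 32 := by field_simp; norm_num
  simp only [id]
  rw [integral_labelErr D (hadm.measurable h hh), integral_labelErr D (hadm.measurable g hg),
    Finset.sum_sub_distrib, sub_div]
  simp only [sampleErr] at hcon
  linarith

/-- On the good event, an epoch keeps the risk minimizer, and it keeps nearly optimal classifiers
only. -/
theorem epoch_spec {I : Input X} (hε : 0 < I.ε) (hadm : Admissible I.H)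
    (hP : I.P.HasGuaranteedError I.H) (herm : IsERM I.erm) {hstar : X → Bool}
    (hmin : IsRiskMinimizer D I.H hstar) {k : ℕ} (hεk : I.epsK k ≤ 2) (hδ0 : 0 < I.deltaK k)
    (hδ1 : I.deltaK k ≤ 1) (hn : 0 < I.sizeU k) {V : Set (X → Bool)} (hV : V ⊆ I.H)
    (hstarV : hstar ∈ V) {u : Fin (I.sizeU k) → X} {s : ℕ → ℕ → X × Bool} (hu : GoodU D I k u)
    (hs : GoodS D I hstar k V u s) :
    hstar ∈ I.epoch k V u s ∧
      ∀ h ∈ I.epoch k V u s, err D h - err D hstar ≤ I.epsK k / 2 := by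
  have hεk0 := I.epsK_pos hε k
  have hHm := hadm.measurable
  set Q := queryLaw D u (I.abstain k V u) with hQ
  set φ := I.phi k V u with hφdef
  have hγ0 := I.abstain_nonneg hε hP k hV u
  have hφ0 : 0 ≤ φ := by
    rw [hφdef, Input.phi]
    exact div_nonneg (Finset.sum_nonneg fun i _ => hγ0 i) (Nat.cast_nonneg _)
  have hQp : IsProbabilityMeasure Q := isProbabilityMeasure_queryLaw D u hγ0
  have hsplit : ∀ h ∈ V, |sampleErr D u h - sampleErr D u hstar - φ * (err Q h - err Q hstar)|
      ≤ I.epsK k / 32 := fun h hh =>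
    abs_sampleErr_sub_le D hε hP k hn hV u hh hstarV (hHm h (hV hh)) (hHm hstar hmin.1)
  have hU : ∀ h ∈ V, (err D h - err D hstar) - (sampleErr D u h - sampleErr D u hstar)
      ≤ I.epsK k / 32 := fun h hh =>
    err_sub_le_of_goodU D hε hadm hεk hδ0 hδ1 hu (hV hh) hmin.1
  -- The minimizer of `D` need not be optimal for the query law. It loses at most `2 ε_k / 32` there
  -- after scaling by `φ`, which is the slack `τ / 2` allowed by the adaptive procedure at `τ = ε_k
  -- / (8 φ)`.
  have hopt : ∀ h ∈ V, φ * (err Q hstar - err Q h) ≤ I.epsK k / 16 := fun h hh => by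
    have h1 := (abs_le.1 (hsplit h hh)).2
    have h2 := hU h hh
    have h3 := hmin.2 h (hV hh)
    linarith
  -- The two `ε_k / 32` terms give `3 ε_k / 16` in all, well below the claimed `ε_k / 2`.
  have hfin : ∀ h ∈ V, φ * (err Q h - err Q hstar) ≤ I.epsK k / 8 →
      err D h - err D hstar ≤ I.epsK k / 2 := fun h hh hle => by
    have h1 := (abs_le.1 (hsplit h hh)).2
    have h2 := hU h hh
    linarith
  rw [Input.epoch]
  rw [GoodS] at hs
  cases hset : I.setting with
  | realizable =>
    simp only [hset] at hs ⊢
    refine ⟨⟨hstarV, fun i _ => hs.1 i⟩, fun h hh => hfin h hh.1 ?_⟩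
    obtain ⟨hhV, hcons⟩ := hh
    have hdiff : err Q h - err Q hstar ≤ 1 := by
      have h1 : err Q h ≤ 1 := measureReal_le_one
      have h2 : 0 ≤ err Q hstar := measureReal_nonneg
      linarith
    -- In the first case `φ < ε_k / 8`, and the trivial bound `1` on the difference of query errors
    -- is enough, however few labels are queried.
    by_cases hx : 768 * φ / I.epsK k < 96
    · rw [div_lt_iff₀ hεk0] at hx
      nlinarith
    · rw [not_lt] at hx
      have hx0 : 0 < 768 * φ / I.epsK k := by linarith
      have hφpos : 0 < φ := by
        rcases hφ0.eq_or_lt with h0 | h0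
        · rw [← h0] at hx0; simp at hx0
        · exact h0
      have hσ := sigma_le_of_numQueries (d := I.d) (m := I.numQueries k φ) hx hδ0 hδ1
        (Nat.le_ceil _)
      have hm : 0 < I.numQueries k φ := by
        refine Nat.ceil_pos.2 (mul_pos hx0 ?_)
        have h1 : 0 ≤ Real.log (768 * φ / I.epsK k) := Real.log_nonneg (by linarith)
        have h2 : 0 < Real.log (48 / I.deltaK k) :=
          Real.log_pos (by rw [lt_div_iff₀ hδ0]; linarith)
        positivity
      have hgood := empErr_sub_le_of_notMem_relDev hHm (hs.2 _ hm rfl) hmin.1 (hV hhV)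
      have e1 : empErr (fun i : Fin (I.numQueries k φ) => s 0 i) hstar = 0 := by
        simp [empErr, hs.1]
      have e2 : empErr (fun i : Fin (I.numQueries k φ) => s 0 i) h = 0 := by
        simp [empErr, fun i : Fin (I.numQueries k φ) => hcons i i.2]
      -- Both classifiers fit all labels, so they agree on the sample and the square-root term
      -- disappears. This is why order `φ_k / ε_k` queries, up to logarithms, suffice in the
      -- realizable case.
      have e3 : empDis (fun i : Fin (I.numQueries k φ) => s 0 i) hstar h = 0 := by
        simp [empDis, hs.1, fun i : Fin (I.numQueries k φ) => hcons i i.2]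
      rw [e1, e2, e3, mul_zero, Real.sqrt_zero, add_zero] at hgood
      have hle : err Q h - err Q hstar ≤ 96 / (768 * φ / I.epsK k) := by linarith
      calc φ * (err Q h - err Q hstar) ≤ φ * (96 / (768 * φ / I.epsK k)) := by gcongr
        _ = I.epsK k / 8 := by field_simp; norm_num
  | agnostic =>
    simp only [hset] at hs ⊢
    by_cases h0 : I.phi k V u = 0
    · rw [if_pos h0]
      refine ⟨hstarV, fun h hh => hfin h hh ?_⟩
      rw [hφdef, h0, zero_mul]
      positivity
    · rw [if_neg h0]
      have hφpos : 0 < φ := lt_of_le_of_ne hφ0 (Ne.symm h0)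
      have hspec := adaptiveQuery_spec herm I.d (V := V) (τ := I.epsK k / (8 * φ))
        (β := I.deltaK k / 2) (by positivity) (by positivity) (by linarith) s Q hstarV
        (fun h hh => by
          have := hopt h hh
          rw [div_div, le_div_iff₀ (by positivity)]
          linarith)
        (fun j hj h hh g hg => empErr_sub_le_of_notMem_relDev hHm (hs j hj) (hV hh) (hV hg))
      refine ⟨hspec.1, fun h hh => hfin h (adaptiveQuery_subset _ _ _ _ _ _ hh) ?_⟩
      have := hspec.2 h hh
      rw [le_div_iff₀ (by positivity)] at this
      linarith

end Epoch

/-! ## All epochs -/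

/-- The first two terms are kept exactly and the rest telescopes. The cruder bound `2` would be too
weak for the union bound over the epochs. -/
theorem sum_range_inv_sq_le (n : ℕ) : ∑ i ∈ Finset.range n, 1 / ((i : ℝ) + 1) ^ 2 ≤ 7 / 4 := by
  have key : ∀ n : ℕ, ∑ i ∈ Finset.range (n + 2), 1 / ((i : ℝ) + 1) ^ 2
      ≤ 7 / 4 - 1 / ((n : ℝ) + 2) := by
    intro n
    induction n with
    | zero => norm_num [Finset.sum_range_succ]
    | succ n ih =>
      rw [Finset.sum_range_succ]
      have : 1 / (((n + 2 : ℕ) : ℝ) + 1) ^ 2 ≤ 1 / ((n : ℝ) + 2) - 1 / ((n + 1 : ℕ) + 2) := by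
        push_cast
        rw [div_sub_div _ _ (by positivity) (by positivity),
          div_le_div_iff₀ (by positivity) (by positivity)]
        nlinarith [Nat.cast_nonneg (α := ℝ) n]
      push_cast at this ih ⊢
      linarith
  refine (Finset.sum_le_sum_of_subset_of_nonneg (Finset.range_subset_range.2 (Nat.le_add_right n 2))
    fun i _ _ => by positivity).trans ((key n).trans ?_)
  have : (0 : ℝ) ≤ 1 / (n + 2) := by positivity
  linarith

/-- The stopping round is random, so all rounds must be good at once; the confidences `1 / (j (j +
1))` telescope to total `1`. -/
theorem tsum_ofReal_round_le {δ : ℝ} (hδ : 0 ≤ δ) :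
    ∑' j : ℕ, ENNReal.ofReal (2 * (δ / 2 / ((j + 1 : ℕ) * ((j + 1 : ℕ) + 1)))) ≤
      ENNReal.ofReal δ := by
  refine ENNReal.tsum_le_of_sum_range_le fun n => ?_
  rw [← ENNReal.ofReal_sum_of_nonneg fun j _ => by positivity]
  refine ENNReal.ofReal_le_ofReal ?_
  have : ∀ n : ℕ, ∑ j ∈ Finset.range n, 2 * (δ / 2 / (((j + 1 : ℕ) : ℝ) * ((j + 1 : ℕ) + 1)))
      = δ - δ / (n + 1) := by
    intro n
    induction n with
    | zero => simp
    | succ n ih =>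
      rw [Finset.sum_range_succ, ih]
      push_cast
      field_simp
      ring
  rw [this]
  have : 0 ≤ δ / ((n : ℝ) + 1) := by positivity
  linarith

section

variable {X : Type*} {I : Input X}

/-- The existence of an epoch forces `log₂ (1 / ε) > 0`, and then rounding up costs less than one
doubling. The bound provides `256 / ε_k ≥ 128`, needed in the estimate of `sigma` for the unlabelled
sample. -/
theorem Input.epsK_le_two (hε : 0 < I.ε) {k : ℕ} (hk : k ∈ Finset.Icc 1 I.k₀) :
    I.epsK k ≤ 2 := by
  rw [Finset.mem_Icc] at hk
  have hpos : 0 < Real.logb 2 (1 / I.ε) := by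
    by_contra h
    have : I.k₀ = 0 := Nat.ceil_eq_zero.2 (not_lt.1 h)
    omega
  have h1 : (I.k₀ : ℝ) < Real.logb 2 (1 / I.ε) + 1 := Nat.ceil_lt_add_one hpos.le
  have h2 : (2 : ℝ) ^ I.k₀ ≤ 2 / I.ε := by
    rw [← Real.rpow_natCast]
    calc (2 : ℝ) ^ (I.k₀ : ℝ) ≤ 2 ^ (Real.logb 2 (1 / I.ε) + 1) :=
          Real.rpow_le_rpow_of_exponent_le (by norm_num) h1.le
      _ = 2 / I.ε := by
          rw [Real.rpow_add (by norm_num), Real.rpow_logb (by norm_num) (by norm_num)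
            (by positivity), Real.rpow_one]
          ring
  rw [Input.epsK]
  calc I.ε * 2 ^ (I.k₀ + 1 - k) ≤ I.ε * 2 ^ I.k₀ := by
        gcongr
        · norm_num
        · omega
    _ ≤ I.ε * (2 / I.ε) := by gcongr
    _ = 2 := by field_simp

theorem Input.deltaK_pos (hδ : 0 < I.δ) {k : ℕ} (hk : k ∈ Finset.Icc 1 I.k₀) : 0 < I.deltaK k := by
  rw [Finset.mem_Icc] at hk
  have : (0 : ℝ) < (I.k₀ + 1 - k : ℕ) := by exact_mod_cast (by omega : 0 < I.k₀ + 1 - k)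
  rw [Input.deltaK]
  positivity

theorem Input.deltaK_le_one (hδ1 : I.δ ≤ 1) {k : ℕ} (hk : k ∈ Finset.Icc 1 I.k₀) :
    I.deltaK k ≤ 1 := by
  rw [Finset.mem_Icc] at hk
  have : (1 : ℝ) ≤ (I.k₀ + 1 - k : ℕ) := by exact_mod_cast (by omega : 1 ≤ I.k₀ + 1 - k)
  rw [Input.deltaK, div_le_one (by positivity)]
  nlinarith

theorem Input.sizeU_pos (hε : 0 < I.ε) (hδ : 0 < I.δ) (hδ1 : I.δ ≤ 1) {k : ℕ}
    (hk : k ∈ Finset.Icc 1 I.k₀) : 0 < I.sizeU k := by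
  have h1 := I.epsK_pos hε k
  have h2 := Input.epsK_le_two hε hk
  have h3 := Input.deltaK_pos hδ hk
  have h4 := Input.deltaK_le_one hδ1 hk
  have h5 : 0 ≤ Real.log (256 / I.epsK k) :=
    Real.log_nonneg (by rw [le_div_iff₀ h1]; linarith)
  have h6 : 0 < Real.log (288 / I.deltaK k) := Real.log_pos (by rw [lt_div_iff₀ h3]; linarith)
  exact Nat.ceil_pos.2 (by positivity)

/-- Read backwards, the confidences are `δ / (2 i ^ 2)`, so the sum is at most `11 / 20 * 7 / 4 * δ
= 77 / 80 * δ`. -/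
theorem Input.sum_deltaK_le (hδ : 0 < I.δ) :
    ∑ i ∈ Finset.range I.k₀, 11 / 10 * I.deltaK (i + 1) ≤ I.δ := by
  have h : ∑ i ∈ Finset.range I.k₀, 11 / 10 * I.deltaK (i + 1)
      = 11 / 20 * I.δ * ∑ i ∈ Finset.range I.k₀, 1 / ((i : ℝ) + 1) ^ 2 := by
    rw [← Finset.sum_range_reflect, Finset.mul_sum]
    refine Finset.sum_congr rfl fun i hi => ?_
    have hi' := Finset.mem_range.1 hi
    rw [Input.deltaK, show I.k₀ + 1 - (I.k₀ - 1 - i + 1) = i + 1 by omega]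
    push_cast
    field_simp
    norm_num
  rw [h]
  nlinarith [sum_range_inv_sq_le I.k₀]

end

/-- If all samples are representative, then all candidate sets contain the risk minimizer. -/
theorem mem_candidates_of_good {X Ω : Type*} [MeasurableSpace X] {D : Measure (X × Bool)}
    [IsProbabilityMeasure D] {I : Input X} {U : (k : ℕ) → Ω → Fin (I.sizeU k) → X}
    {S : ℕ → Ω → ℕ → ℕ → X × Bool} (hε : 0 < I.ε) (hδ : 0 < I.δ) (hδ1 : I.δ ≤ 1)
    (hadm : Admissible I.H) (hP : I.P.HasGuaranteedError I.H) (herm : IsERM I.erm)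
    {hstar : X → Bool} (hmin : IsRiskMinimizer D I.H hstar) {ω : Ω}
    (hgood : ∀ k ∈ Finset.Icc 1 I.k₀, GoodU D I k (U k ω) ∧
      GoodS D I hstar k (current U S k ω) (U k ω) (S k ω)) (k : ℕ) (hk : k ≤ I.k₀) :
    hstar ∈ I.candidates (fun l => U l ω) (fun l => S l ω) k := by
  induction k with
  | zero => exact hmin.1
  | succ k ih =>
    have hk' : k + 1 ∈ Finset.Icc 1 I.k₀ := Finset.mem_Icc.2 ⟨by omega, hk⟩
    exact (epoch_spec D hε hadm hP herm hmin (Input.epsK_le_two hε hk') (Input.deltaK_pos hδ hk')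
      (Input.deltaK_le_one hδ1 hk') (Input.sizeU_pos hε hδ hδ1 hk')
      (I.candidates_subset _ _ _) (ih (by omega)) (hgood _ hk').1 (hgood _ hk').2).1

section Run

variable {X Ω : Type*} [MeasurableSpace X] [MeasurableSpace Ω] {D : Measure (X × Bool)}
  [IsProbabilityMeasure D] {I : Input X} {μ : Measure Ω} [IsProbabilityMeasure μ]
  {U : (k : ℕ) → Ω → Fin (I.sizeU k) → X} {S : ℕ → Ω → ℕ → ℕ → X × Bool}

/-- The labelled examples of an epoch are representative with probability at least `1 - δ_k`. -/
theorem measure_not_goodS_le (hε : 0 < I.ε) (hδ : 0 < I.δ) (hδ1 : I.δ ≤ 1)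
    (hadm : Admissible I.H) (hvc : HasVCDim I.H I.d) (hP : I.P.HasGuaranteedError I.H)
    {hstar : X → Bool} (hmin : IsRiskMinimizer D I.H hstar)
    (hreal : I.setting = Setting.realizable → err D hstar = 0) (hrun : IsRun D I μ U S) {k : ℕ}
    (hk : k ∈ Finset.Icc 1 I.k₀) :
    μ {ω | ¬ GoodS D I hstar k (current U S k ω) (U k ω) (S k ω)}
      ≤ ENNReal.ofReal (I.deltaK k) := by
  have hδ0 := Input.deltaK_pos hδ hk
  have hδk1 := Input.deltaK_le_one hδ1 hk
  obtain ⟨w, hw, hwe⟩ := exists_measurable_version hrun hk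
  cases hset : I.setting with
  | realizable =>
    -- The number of queries is random, but it is determined by the abstention probabilities.
    -- Conditioning on its value costs no union bound: the events are disjoint, and the failure
    -- probabilities `δ_k μ(C m)` add up to at most `δ_k`.
    let C : ℕ → Set ((Fin (I.sizeU k) → X) × (Fin (I.sizeU k) → ℝ)) :=
      fun m => {v | I.numQueries k ((∑ i, v.2 i) / I.sizeU k) = m}
    have hf : Measurable fun v : (Fin (I.sizeU k) → X) × (Fin (I.sizeU k) → ℝ) =>
        I.numQueries k ((∑ i, v.2 i) / I.sizeU k) := by
      simp only [Input.numQueries]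
      refine Nat.measurable_ceil.comp ?_
      have : Measurable fun v : (Fin (I.sizeU k) → X) × (Fin (I.sizeU k) → ℝ) =>
          (∑ i, v.2 i) / I.sizeU k :=
        (Finset.measurable_sum _ fun i _ => by fun_prop).div_const _
      have h2 := (this.const_mul 768).div_const (I.epsK k)
      exact h2.mul ((h2.log.const_mul _).add_const _)
    have hC : ∀ m, MeasurableSet (C m) := fun m => hf (measurableSet_singleton m)
    have hw' : Measurable w := hw.mono (pastU_le hrun hk) le_rfl
    have hm : ∀ m, μ {ω | (0 < m ∧ (U k ω, weights U S k ω) ∈ C m) ∧ (fun i : Fin m => S k ω 0 i) ∈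
        relDev I.H Prod.fst zeroOne (sigma I.d m (I.deltaK k / 2)) m
          (queryLaw D (U k ω) (weights U S k ω))}
        ≤ ENNReal.ofReal (I.deltaK k) * μ (w ⁻¹' C m) := fun m => by
      rcases Nat.eq_zero_or_pos m with h0 | hm0
      · simp [h0]
      · have := measure_relDev_labelled_le hε hP hadm hvc hrun hk hw hwe 0 hm0
          (δ := I.deltaK k / 2) (by positivity) (by linarith) (hC m)
        rw [show 2 * (I.deltaK k / 2) = I.deltaK k by ring] at this
        refine le_trans (measure_mono ?_) this
        exact fun ω hω => ⟨hω.1.2, hω.2⟩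
    have hnull := ae_forall_eq_of_err_eq_zero hrun hk (hadm.measurable hstar hmin.1) (hreal hset)
    calc μ {ω | ¬ GoodS D I hstar k (current U S k ω) (U k ω) (S k ω)}
        ≤ μ (⋃ m, {ω | (0 < m ∧ (U k ω, weights U S k ω) ∈ C m) ∧ (fun i : Fin m => S k ω 0 i) ∈
          relDev I.H Prod.fst zeroOne (sigma I.d m (I.deltaK k / 2)) m
          (queryLaw D (U k ω) (weights U S k ω))}) := by
          refine measure_mono_ae ?_
          filter_upwards [hnull] with ω hω hbad
          by_contra hcon
          refine hbad ?_
          rw [GoodS, hset]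
          refine ⟨hω, fun m hm0 hme hdev => hcon (Set.mem_iUnion.2 ⟨m, ⟨hm0, hme⟩, hdev⟩)⟩
      _ ≤ ∑' m, ENNReal.ofReal (I.deltaK k) * μ (w ⁻¹' C m) :=
          (measure_iUnion_le _).trans (ENNReal.tsum_le_tsum hm)
      _ = ENNReal.ofReal (I.deltaK k) * μ (⋃ m, w ⁻¹' C m) := by
          rw [ENNReal.tsum_mul_left, measure_iUnion (fun a b hab => ?_) fun m => hw' (hC m)]
          refine Set.disjoint_left.2 fun ω (ha : _ = a) (hb : _ = b) => hab (ha.symm.trans hb)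
      _ ≤ ENNReal.ofReal (I.deltaK k) := mul_le_of_le_one_right' prob_le_one
  | agnostic =>
    calc μ {ω | ¬ GoodS D I hstar k (current U S k ω) (U k ω) (S k ω)}
        ≤ μ (⋃ j : ℕ, {ω | (U k ω, weights U S k ω) ∈ Set.univ ∧
          (fun i : Fin (2 ^ (j + 1)) => S k ω (j + 1) i) ∈ relDev I.H Prod.fst zeroOne
          (sigma I.d (2 ^ (j + 1)) (I.deltaK k / 2 / ((j + 1 : ℕ) * ((j + 1 : ℕ) + 1))))
          (2 ^ (j + 1)) (queryLaw D (U k ω) (weights U S k ω))}) := by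
          refine measure_mono fun ω hbad => ?_
          by_contra hcon
          refine hbad ?_
          rw [GoodS, hset]
          intro j hj hdev
          obtain ⟨i, rfl⟩ : ∃ i, j = i + 1 := ⟨j - 1, by omega⟩
          exact hcon (Set.mem_iUnion.2 ⟨i, Set.mem_univ _, hdev⟩)
      _ ≤ ∑' j : ℕ, ENNReal.ofReal
            (2 * (I.deltaK k / 2 / ((j + 1 : ℕ) * ((j + 1 : ℕ) + 1)))) := by
          refine (measure_iUnion_le _).trans (ENNReal.tsum_le_tsum fun j => ?_)
          have hle : I.deltaK k / 2 / ((j + 1 : ℕ) * ((j + 1 : ℕ) + 1)) ≤ 1 := by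
            push_cast
            rw [div_le_one (by positivity)]
            nlinarith [Nat.cast_nonneg (α := ℝ) j]
          have := measure_relDev_labelled_le hε hP hadm hvc hrun hk hw hwe (j + 1)
            (n := 2 ^ (j + 1)) (by positivity)
            (δ := I.deltaK k / 2 / ((j + 1 : ℕ) * ((j + 1 : ℕ) + 1))) (by positivity) hle
            MeasurableSet.univ
          rwa [Set.preimage_univ, measure_univ, mul_one] at this
      _ ≤ ENNReal.ofReal (I.deltaK k) := tsum_ofReal_round_le hδ0.le

/-- Both samples of an epoch are representative with probability at least `1 - (11 / 10) δ_k`. -/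
theorem measure_not_good_le (hε : 0 < I.ε) (hδ : 0 < I.δ) (hδ1 : I.δ ≤ 1)
    (hadm : Admissible I.H) (hvc : HasVCDim I.H I.d) (hP : I.P.HasGuaranteedError I.H)
    {hstar : X → Bool} (hmin : IsRiskMinimizer D I.H hstar)
    (hreal : I.setting = Setting.realizable → err D hstar = 0) (hrun : IsRun D I μ U S) {k : ℕ}
    (hk : k ∈ Finset.Icc 1 I.k₀) :
    μ {ω | ¬ (GoodU D I k (U k ω) ∧ GoodS D I hstar k (current U S k ω) (U k ω) (S k ω))}
      ≤ ENNReal.ofReal (11 / 10 * I.deltaK k) := by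
  have hδ0 := Input.deltaK_pos hδ hk
  have hδk1 := Input.deltaK_le_one hδ1 hk
  have h1 := measure_not_goodS_le hε hδ hδ1 hadm hvc hP hmin hreal hrun hk
  have h2 := measure_relDev_unlabelled_le hadm hvc hrun hk (Input.sizeU_pos hε hδ hδ1 hk)
    (δ := I.deltaK k / 20) (by positivity) (by linarith)
  rw [show 11 / 10 * I.deltaK k = 2 * (I.deltaK k / 20) + I.deltaK k by ring,
    ENNReal.ofReal_add (by positivity) hδ0.le]
  refine le_trans (measure_mono fun ω hω => ?_) ((measure_union_le _ _).trans (add_le_add h2 h1))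
  by_contra hcon
  simp only [Set.mem_union, Set.mem_ofPred_eq, not_or, not_not] at hcon
  exact hω hcon

end Run

end ActiveLearning

theorem mainTheorem2 {X Ω : Type*} [MeasurableSpace X] [MeasurableSpace Ω]
    (D : Measure (X × Bool)) [IsProbabilityMeasure D]
    (I : ActiveLearning.Input X)
    (hεpos : 0 < I.ε) (hδpos : 0 < I.δ)
    (hadm : ActiveLearning.Admissible I.H) (hvc : ActiveLearning.HasVCDim I.H I.d)
    (hP : I.P.HasGuaranteedError I.H) (herm : ActiveLearning.IsERM I.erm)
    (hstar : X → Bool) (hmin : ActiveLearning.IsRiskMinimizer D I.H hstar)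
    (hreal : I.setting = ActiveLearning.Setting.realizable → ActiveLearning.err D hstar = 0)
    (μ : Measure Ω) [IsProbabilityMeasure μ]
    (U : (k : ℕ) → Ω → Fin (I.sizeU k) → X) (S : ℕ → Ω → ℕ → ℕ → X × Bool)
    (hrun : ActiveLearning.IsRun D I μ U S) :
    ∃ E : Set Ω, MeasurableSet E ∧ ENNReal.ofReal (1 - I.δ) ≤ μ E ∧
      ∀ ω ∈ E, (I.candidates (fun k => U k ω) (fun k => S k ω) I.k₀).Nonempty ∧
        ∀ hhat ∈ I.candidates (fun k => U k ω) (fun k => S k ω) I.k₀,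
          hhat ∈ I.H ∧ ActiveLearning.err D hhat - ActiveLearning.err D hstar ≤ I.ε := by
  open ActiveLearning in
  classical
  rcases le_or_gt 1 I.δ with hδ1 | hδ1
  · exact ⟨∅, MeasurableSet.empty, by rw [ENNReal.ofReal_of_nonpos (by linarith)]; exact zero_le,
      fun ω hω => hω.elim⟩
  let bad : ℕ → Set Ω := fun k =>
    {ω | ¬ (GoodU D I k (U k ω) ∧ GoodS D I hstar k (current U S k ω) (U k ω) (S k ω))}
  let B : Set Ω := ⋃ i ∈ Finset.range I.k₀, bad (i + 1)
  have hB : μ B ≤ ENNReal.ofReal I.δ := by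
    calc μ B ≤ ∑ i ∈ Finset.range I.k₀, μ (bad (i + 1)) := measure_biUnion_finset_le _ _
      _ ≤ ∑ i ∈ Finset.range I.k₀, ENNReal.ofReal (11 / 10 * I.deltaK (i + 1)) :=
          Finset.sum_le_sum fun i hi => measure_not_good_le hεpos hδpos hδ1.le hadm hvc hP hmin
            hreal hrun (Finset.mem_Icc.2 ⟨by omega, by have := Finset.mem_range.1 hi; omega⟩)
      _ = ENNReal.ofReal (∑ i ∈ Finset.range I.k₀, 11 / 10 * I.deltaK (i + 1)) := by
          refine (ENNReal.ofReal_sum_of_nonneg fun i _ => ?_).symm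
          rw [Input.deltaK]
          positivity
      _ ≤ ENNReal.ofReal I.δ := ENNReal.ofReal_le_ofReal (Input.sum_deltaK_le hδpos)
  -- The bad event itself need not be measurable; the complement of its measurable hull serves as
  -- the event `E`.
  have hBm : MeasurableSet (toMeasurable μ B) := measurableSet_toMeasurable μ B
  refine ⟨(toMeasurable μ B)ᶜ, hBm.compl, ?_, fun ω hω => ?_⟩
  · rw [prob_compl_eq_one_sub hBm, measure_toMeasurable, ENNReal.ofReal_sub _ hδpos.le,
      ENNReal.ofReal_one]
    gcongr
  have hωB : ω ∉ B := fun h => hω (subset_toMeasurable μ B h)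
  have hgood : ∀ k ∈ Finset.Icc 1 I.k₀, GoodU D I k (U k ω) ∧
      GoodS D I hstar k (current U S k ω) (U k ω) (S k ω) := fun k hk => by
    rw [Finset.mem_Icc] at hk
    by_contra hcon
    refine hωB (Set.mem_biUnion (x := k - 1) (Finset.mem_range.2 (by omega)) ?_)
    rw [Nat.sub_add_cancel hk.1]
    exact hcon
  have hmem := mem_candidates_of_good hεpos hδpos hδ1.le hadm hP herm hmin hgood
  refine ⟨⟨hstar, hmem I.k₀ le_rfl⟩, fun h hh => ⟨I.candidates_subset _ _ _ hh, ?_⟩⟩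
  -- Without any epoch `ε ≥ 1`, and since errors lie in `[0, 1]` every classifier of `H` will do.
  rcases Nat.eq_zero_or_pos I.k₀ with h0 | hpos
  · have hlog : Real.logb 2 (1 / I.ε) ≤ 0 := Nat.ceil_eq_zero.1 h0
    have hε1 : 1 ≤ I.ε := by
      by_contra hlt
      have : 0 < Real.logb 2 (1 / I.ε) :=
        Real.logb_pos (by norm_num) (by rw [lt_div_iff₀ hεpos]; linarith)
      linarith
    have h1 : err D h ≤ 1 := measureReal_le_one
    have h2 : 0 ≤ err D hstar := measureReal_nonneg
    linarith
  · obtain ⟨K, hK⟩ : ∃ K, I.k₀ = K + 1 := ⟨I.k₀ - 1, by omega⟩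
    have hk : K + 1 ∈ Finset.Icc 1 I.k₀ := Finset.mem_Icc.2 ⟨by omega, hK.ge⟩
    rw [hK] at hh
    have := (epoch_spec D hεpos hadm hP herm hmin (Input.epsK_le_two hεpos hk)
      (Input.deltaK_pos hδpos hk) (Input.deltaK_le_one hδ1.le hk)
      (Input.sizeU_pos hεpos hδpos hδ1.le hk) (I.candidates_subset _ _ _) (hmem K (by omega))
      (hgood _ hk).1 (hgood _ hk).2).2 h hh
    have hε2 : I.epsK (K + 1) / 2 = I.ε := by
      rw [Input.epsK, hK, Nat.add_sub_cancel_left]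
      ring
    rwa [hε2] at this
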